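/- **Setting.** For density matrices $\rho,\sigma$ on a finite-dimensional Hilbert space let $d_{\mathrm{tr}}(\rho,\sigma)=\tfrac12\|\rho-\sigma\|_1$. For a distance $d$, $\mathcal N(K,d,r)$ is the smallest cardinality of a set $C\subseteq K$ such that every $x\in K$ has some $y\in C$ with $d(x,y)\le r$, and $\mathcal M(K,d,r)$ is the largest cardinality of a set $C\subseteq K$ with $d(x,y)>r$ for all distinct $x,y\in C$. Let $\epsilon,\eta\in(0,1)$, let $\mathcal U\subseteq U(2^n)$ be a class of $n$-qubit unitaries, let $S$ be a set of input states (possibly with ancillas) and $P$ a probability distribution over $S$. For each $V\in U(2^n)$ let $f_V$ be a (measurable) map from input states to output states; $f_V(\rho)$ is the output obtained from $\rho$ by applying $V$. Put $\mathcal F_{\mathcal U}=\{f_V: V\in\mathcal U\}$, $$d_P(f_V,f_W)=\sqrt{\mathbb E_{\rho\sim P}\big[d_{\mathrm{tr}}(f_V(\rho),f_W(\rho))^2\big]},\qquad \mathcal N_\eta=\sup_{\rho\in S}\mathcal N\big(\{f_V(\rho):V\in\mathcal U\},d_{\mathrm{tr}},\eta\big).$$ A learner using $N$ $\eta$-noisy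 classically described samples is a randomized algorithm that successively chooses input states $\rho_1,\dots,\rho_N\in S$ (fixed, random or adaptive), receives for each of them a state $\tilde\sigma_i$ with $d_{\mathrm{tr}}(\tilde\sigma_i,f_U(\rho_i))\le\eta$, and outputs a unitary $\hat U\in U(2^n)$ computed from the classical descriptions $(\rho_i,\tilde\sigma_i)_{i\le N}$. It learns $\mathcal U$ to accuracy $\epsilon$ if, for every $U\in\mathcal U$ and every such choice of noisy responses (a state depending on the round and on the input state), $d_P(f_{\hat U},f_U)\le\epsilon$ with probability at least $2/3$. **Theorem (information-theoretic quantum no-free-lunch).** (1) There is a universal constant $c>0$ such that, in the above setting, if some learner learns $\mathcal U$ to accuracy $\epsilon$ from $N$ $\eta$-noisy samples, then $\mathcal M(\mathcal F_{\mathcal U},d_P,2\epsilon+6\eta)$ and $\mathcal N_\eta$ are finite and $$N\cdot\log\mathcal N_\eta\;\ge\; c\,\log\mathcal M(\mathcal F_{\mathcal U},d_P,2\epsilon+6\eta)$$ (with the convention $\log 0=0$ for empty $\mathcal U$), that is, $N\ge\Omega\big(\log\mathcal M(\mathcal F_{\mathcal U},d_P,2\epsilon+6\eta)/\log\mathcal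 N_\eta\big)$. (2) A distribution $\nu$ on $U(2^n)$ is locally scrambled up to the second moment if there is a distribution $\nu'$ on $U(2^n)$ that is invariant under $U\mapsto U\,(V_1\otimes\cdots\otimes V_n)$ for all single-qubit unitaries $V_1,\dots,V_n$ and satisfies $\mathbb E_{U\sim\nu}[U^{\otimes2}\rho(U^\dagger)^{\otimes2}]=\mathbb E_{U\sim\nu'}[U^{\otimes2}\rho(U^\dagger)^{\otimes2}]$ for every $2n$-qubit density matrix $\rho$; the law $P$ of $U|0\rangle^{\otimes n}$ with $U\sim\nu$ is then called a locally scrambled ensemble of $n$-qubit pure states up to the second moment. There is a universal constant $\delta>0$, and for all $0<a\le b$ a constant $c>0$ depending only on $a,b$, such that for all $n\ge1$, all such ensembles $P$, and all $\epsilon,\eta\in(0,1)$ with $a\epsilon\le\eta\le b\epsilon$ (i.e. $\eta=\Theta(\epsilon)$) and $2\epsilon+6\eta\le\delta$: any learner that learns $\mathcal U=U(2^n)$ to accuracy $\epsilon$ from $N$ $\eta$-noisy samples, with $S$ the support of $P$ and $f_U(\rho)=U\rho U^\dagger$, uses $N\ge c\,2^n$ samples. -/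

import Mathlib

open MeasureTheory Matrix
open scoped ComplexOrder Kronecker

noncomputable section

namespace QNFL

/-! ### States, unitaries, trace distance -/

/-- Matrices carry the Borel σ-algebra; states and unitaries inherit it as subtypes. -/
instance matrixMeasurableSpace {m n : Type*} : MeasurableSpace (Matrix m n ℂ) := borel _

instance matrixBorelSpace {m n : Type*} : BorelSpace (Matrix m n ℂ) := ⟨rfl⟩

/-- Density matrices on the Hilbert space `ℂ^ι`: positive semidefinite of trace one. -/
abbrev DensityMatrix (ι : Type*) [Fintype ι] : Type _ :=
  {ρ : Matrix ι ι ℂ // ρ.PosSemidef ∧ ρ.trace = 1}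

/-- The computational basis of `n` qubits is indexed by bit strings of length `n`. -/
abbrev Qubits (n : ℕ) : Type := Fin n → Fin 2

/-- The group `U(2^n)` of `n`-qubit unitaries. -/
abbrev QubitUnitary (n : ℕ) : Type := Matrix.unitaryGroup (Qubits n) ℂ

/-- Trace distance `‖ρ - σ‖₁ / 2`; the trace norm of the Hermitian matrix `ρ - σ` is the sum of
the absolute values of its eigenvalues (with multiplicity). -/
def traceDist {ι : Type*} [Fintype ι] [DecidableEq ι] (ρ σ : DensityMatrix ι) : ℝ :=
  (1 / 2) * ∑ i, |(ρ.2.1.isHermitian.sub σ.2.1.isHermitian).eigenvalues i|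

/-- The state `U ρ U†`. -/
def conjState {ι : Type*} [Fintype ι] [DecidableEq ι] (U : Matrix.unitaryGroup ι ℂ)
    (ρ : DensityMatrix ι) : DensityMatrix ι :=
  ⟨(U : Matrix ι ι ℂ) * ρ.1 * (U : Matrix ι ι ℂ)ᴴ, ρ.2.1.mul_mul_conjTranspose_same _, by
    have h : (U : Matrix ι ι ℂ)ᴴ * (U : Matrix ι ι ℂ) = 1 := Matrix.mem_unitaryGroup_iff'.1 U.2
    rw [Matrix.trace_mul_comm, ← Matrix.mul_assoc, h, Matrix.one_mul]
    exact ρ.2.2⟩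

/-- The pure state `|0⟩⟨0|^{⊗ n}`. -/
def zeroState (n : ℕ) : DensityMatrix (Qubits n) :=
  ⟨Matrix.diagonal (Pi.single 0 1),
    Matrix.PosSemidef.diagonal (Pi.single_nonneg.2 zero_le_one),
    by simp [Matrix.trace_diagonal]⟩

/-! ### Covering and packing numbers with respect to an explicit distance -/

/-- The covering number `𝒩(K, d, r)`: smallest cardinality of a set `C ⊆ K` such that every point
of `K` is within distance `r` of a point of `C`. -/
def coveringNumber {X : Type*} (K : Set X) (d : X → X → ℝ) (r : ℝ) : ℕ∞ :=
  ⨅ (C : Set X) (_ : C ⊆ K) (_ : ∀ x ∈ K, ∃ y ∈ C, d x y ≤ r), C.encard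

/-- The packing number `ℳ(K, d, r)`: largest cardinality of a set `C ⊆ K` whose distinct points
have pairwise distance larger than `r`. -/
def packingNumber {X : Type*} (K : Set X) (d : X → X → ℝ) (r : ℝ) : ℕ∞ :=
  ⨆ (C : Set X) (_ : C ⊆ K) (_ : C.Pairwise fun x y => r < d x y), C.encard

/-- Root mean squared trace distance `√(𝔼_{ρ ∼ P} dtr(g ρ, h ρ)²)` of two maps on states. -/
def rmsDist {ι κ : Type*} [Fintype ι] [Fintype κ] [DecidableEq κ] (P : Measure (DensityMatrix ι))
    (g h : DensityMatrix ι → DensityMatrix κ) : ℝ :=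
  √(∫ ρ, traceDist (g ρ) (h ρ) ^ 2 ∂P)

/-- `𝒩_η = sup_{ρ ∈ S} 𝒩({f_V(ρ) : V ∈ 𝒰}, dtr, η)`. -/
def maxCoveringNumber {G ι κ : Type*} [Fintype ι] [Fintype κ] [DecidableEq κ]
    (f : G → DensityMatrix ι → DensityMatrix κ) (𝒰 : Set G) (S : Set (DensityMatrix ι))
    (η : ℝ) : ℕ∞ :=
  ⨆ ρ ∈ S, coveringNumber ((fun V => f V ρ) '' 𝒰) traceDist η

/-! ### Learning from noisy classically described data -/

/-- A randomized learner with random seed in `Ω`, inputs in `X`, responses in `Y` and hypotheses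
in `G`. Each input may depend on the seed and on the data collected so far (fixed inputs and inputs
drawn at random in advance are special cases); the hypothesis depends on the seed and on all the
data. -/
structure Learner (Ω X Y G : Type*) where
  query : Ω → List (X × Y) → X
  output : Ω → List (X × Y) → G

/-- The first `N` samples `(x_0, y_0), …, (x_{N-1}, y_{N-1})` that the learner with seed `ω`
collects when the response to the input `x` in round `k` is `g k x`. -/
def Learner.data {Ω X Y G : Type*} (H : Learner Ω X Y G) (g : ℕ → X → Y) (ω : Ω) :
    ℕ → List (X × Y)
  | 0 => []
  | k + 1 =>
      H.data g ω k ++ [(H.query ω (H.data g ω k), g k (H.query ω (H.data g ω k)))]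

/-- The learner `H` with inputs from `S`, whose seed has law `μ`, learns the class `𝒰` from `N`
samples with `η`-noisy responses: for every unknown `U ∈ 𝒰` and every choice of responses
within trace distance `η` of the true output states `f_U(ρ)`, its hypothesis `Û` satisfies
`d_P(f_Û, f_U) ≤ ε` with probability at least `2/3`. (The set `A` takes care of success events that
are not measurable.) -/
def Learns {Ω G ι κ : Type*} [MeasurableSpace Ω] [Fintype ι] [Fintype κ] [DecidableEq κ]
    (μ : Measure Ω) (f : G → DensityMatrix ι → DensityMatrix κ) (𝒰 : Set G)
    (S : Set (DensityMatrix ι)) (P : Measure (DensityMatrix ι)) (ε η : ℝ) (N : ℕ)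
    (H : Learner Ω S (DensityMatrix κ) G) : Prop :=
  ∀ U ∈ 𝒰, ∀ g : ℕ → S → DensityMatrix κ,
    (∀ k (ρ : S), traceDist (g k ρ) (f U ρ) ≤ η) →
    ∃ A : Set Ω, MeasurableSet A ∧ 2 / 3 ≤ μ A ∧
      ∀ ω ∈ A, rmsDist P (f (H.output ω (H.data g ω N))) (f U) ≤ ε

/-! ### Locally scrambled ensembles -/

/-- The tensor product `V_0 ⊗ ⋯ ⊗ V_{n-1}` of single-qubit unitaries. -/
def tensorUnitary {n : ℕ} (V : Fin n → Matrix.unitaryGroup (Fin 2) ℂ) : QubitUnitary n :=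
  ⟨Matrix.of fun x y => ∏ i, (V i : Matrix (Fin 2) (Fin 2) ℂ) (x i) (y i), by
    rw [Matrix.mem_unitaryGroup_iff]
    ext x y
    have h : ∀ i, ∑ z, (V i : Matrix (Fin 2) (Fin 2) ℂ) (x i) z *
        star ((V i : Matrix (Fin 2) (Fin 2) ℂ) (y i) z) = if x i = y i then 1 else 0 := by
      intro i
      have := congrFun (congrFun (Matrix.mem_unitaryGroup_iff.1 (V i).2) (x i)) (y i)
      simpa [Matrix.mul_apply, Matrix.one_apply, Matrix.star_apply] using this
    simp only [Matrix.mul_apply, Matrix.star_apply, Matrix.of_apply, Matrix.one_apply,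
      star_prod, ← Finset.prod_mul_distrib]
    have key := (Finset.prod_univ_sum (fun _ : Fin n => (Finset.univ : Finset (Fin 2)))
      (fun i z => (V i : Matrix (Fin 2) (Fin 2) ℂ) (x i) z *
        star ((V i : Matrix (Fin 2) (Fin 2) ℂ) (y i) z))).symm
    rw [Fintype.piFinset_univ, Finset.prod_congr rfl fun i _ => h i] at key
    refine key.trans ?_
    by_cases hxy : x = y
    · simp [hxy]
    · obtain ⟨i, hi⟩ := Function.ne_iff.1 hxy
      rw [if_neg hxy]
      exact Finset.prod_eq_zero (Finset.mem_univ i) (if_neg hi)⟩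

/-- `𝔼_{U ∼ ν} [U^{⊗2} ρ (U†)^{⊗2}]`, computed entrywise. -/
def secondMoment {n : ℕ} (ν : Measure (QubitUnitary n)) (ρ : DensityMatrix (Qubits n × Qubits n)) :
    Matrix (Qubits n × Qubits n) (Qubits n × Qubits n) ℂ :=
  Matrix.of fun a b =>
    ∫ U, (((U : Matrix (Qubits n) (Qubits n) ℂ) ⊗ₖ (U : Matrix (Qubits n) (Qubits n) ℂ)) * ρ.1 *
      ((U : Matrix (Qubits n) (Qubits n) ℂ) ⊗ₖ (U : Matrix (Qubits n) (Qubits n) ℂ))ᴴ) a b ∂ν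

/-- A unitary ensemble that is locally scrambled up to the second moment: its second moments agree
with those of an ensemble that is invariant under right multiplication by tensor products of
single-qubit unitaries. -/
def IsLocallyScrambledUnitary {n : ℕ} (ν : Measure (QubitUnitary n)) : Prop :=
  ∃ ν' : Measure (QubitUnitary n), IsProbabilityMeasure ν' ∧
    (∀ V : Fin n → Matrix.unitaryGroup (Fin 2) ℂ,
      ν'.map (fun U => U * tensorUnitary V) = ν') ∧
    ∀ ρ : DensityMatrix (Qubits n × Qubits n), secondMoment ν ρ = secondMoment ν' ρ

/-- An ensemble of `n`-qubit pure states that is locally scrambled up to the second moment: the law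
of `U |0⟩^{⊗n}` for a unitary ensemble that is locally scrambled up to the second moment. -/
def IsLocallyScrambled {n : ℕ} (P : Measure (DensityMatrix (Qubits n))) : Prop :=
  ∃ ν : Measure (QubitUnitary n), IsProbabilityMeasure ν ∧ IsLocallyScrambledUnitary ν ∧
    P = ν.map (fun U => conjState U (zeroState n))

end QNFL

end

/-!
Round every noisy response to a point of an `η`-net of the outputs that are possible at the queried
input. For each seed a learner then sees at most `𝒩_η ^ N` transcripts. Targets more than `2ε`
apart cannot share a transcript on which both are learned, and each of them is learned for two
thirds of the seeds, so a packing of `m` targets satisfies `2/3 * m ≤ 𝒩_η ^ N`.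

For a locally scrambled ensemble, averaging over the products of the six single-qubit stabilizer
states, which form a 2-design, turns local invariance into
`𝔼 |⟨ψ|X|ψ⟩|² ≤ 1/3 + 2/3 * |tr X|² / 4 ^ n` for unitary `X`. With `X = U†V` this bounds the squared
distance of two unitaries from below by two thirds of their infidelity `1 - |tr U†V|² / 4 ^ n`. A
large packing for the infidelity is obtained by choosing `2 ^ (n - 1)` orthonormal columns one after
another, each from a separated subset of the unit sphere orthogonal to its predecessors: for a fixed
unitary `V` few of the resulting branches agree with `V` in most columns. The packing number thus
has logarithm of order `4 ^ n * log (1 / ε)`, while the outputs are pure states, for which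
`log 𝒩_η` is only of order `2 ^ n * log (1 / η)`.
-/

noncomputable section

namespace QNFL

/-! ### Coverings and packings -/

section Packing

variable {X Y : Type*} {K : Set X} {K' : Set Y} {d : X → X → ℝ} {d' : Y → Y → ℝ} {r r' : ℝ}

theorem exists_maximal_pairwise {R : X → X → Prop} (hR : ∀ x y, R x y → R y x) (K : Set X) :
    ∃ C ⊆ K, C.Pairwise R ∧ ∀ x ∈ K, x ∉ C → ∃ y ∈ C, ¬R x y := by
  obtain ⟨C, hC⟩ := zorn_subset {C : Set X | C ⊆ K ∧ C.Pairwise R} fun c hc hchain =>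
    ⟨⋃₀ c, ⟨Set.sUnion_subset fun s hs => (hc hs).1,
      (Set.pairwise_sUnion hchain.directedOn).2 fun s hs => (hc hs).2⟩,
      fun _ => Set.subset_sUnion_of_mem⟩
  refine ⟨C, hC.prop.1, hC.prop.2, fun x hxK hxC => ?_⟩
  by_contra! hx
  have hinsert : (insert x C).Pairwise R :=
    hC.prop.2.insert fun y hy _ => ⟨hx y hy, hR _ _ (hx y hy)⟩
  exact hxC (hC.le_of_ge ⟨Set.insert_subset hxK hC.prop.1, hinsert⟩ (Set.subset_insert x C)
    (Set.mem_insert x C))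

theorem exists_maximal_separated (hself : ∀ x, d x x ≤ r) (hcomm : ∀ x y, d x y = d y x)
    (K : Set X) :
    ∃ C ⊆ K, (C.Pairwise fun x y => r < d x y) ∧ ∀ x ∈ K, ∃ y ∈ C, d x y ≤ r := by
  obtain ⟨C, hCK, hsep, hmax⟩ :=
    exists_maximal_pairwise (R := fun x y => r < d x y) (fun x y h => hcomm x y ▸ h) K
  refine ⟨C, hCK, hsep, fun x hx => ?_⟩
  by_cases hxC : x ∈ C
  · exact ⟨x, hxC, hself x⟩
  · simpa only [not_lt] using hmax x hx hxC

theorem coveringNumber_le_encard {C : Set X} (hCK : C ⊆ K) (hC : ∀ x ∈ K, ∃ y ∈ C, d x y ≤ r) :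
    coveringNumber K d r ≤ C.encard :=
  iInf₂_le_of_le C hCK (iInf_le _ hC)

theorem encard_le_packingNumber {C : Set X} (hCK : C ⊆ K) (hC : C.Pairwise fun x y => r < d x y) :
    C.encard ≤ packingNumber K d r :=
  le_iSup₂_of_le C hCK (le_iSup_of_le hC le_rfl)

theorem coveringNumber_le_packingNumber (hself : ∀ x, d x x ≤ r)
    (hcomm : ∀ x y, d x y = d y x) : coveringNumber K d r ≤ packingNumber K d r := by
  obtain ⟨C, hCK, hsep, hcov⟩ := exists_maximal_separated hself hcomm K
  exact (coveringNumber_le_encard hCK hcov).trans (encard_le_packingNumber hCK hsep)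

theorem exists_cover_of_coveringNumber_le {q : ℕ} (h : coveringNumber K d r ≤ q) :
    ∃ C ⊆ K, (∀ x ∈ K, ∃ y ∈ C, d x y ≤ r) ∧ C.encard ≤ q := by
  have hlt : coveringNumber K d r < q + 1 := h.trans_lt (by exact_mod_cast q.lt_succ_self)
  simp only [coveringNumber, iInf_lt_iff] at hlt
  obtain ⟨C, hCK, hC, hCq⟩ := hlt
  exact ⟨C, hCK, hC, Order.le_of_lt_add_one hCq⟩

theorem exists_finset_of_le_packingNumber {q : ℕ} (h : q ≤ packingNumber K d r) :
    ∃ t : Finset X, ↑t ⊆ K ∧ ((t : Set X).Pairwise fun x y => r < d x y) ∧ t.card = q := by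
  obtain ⟨C, hCK, hsep, hq⟩ :
      ∃ C ⊆ K, (C.Pairwise fun x y => r < d x y) ∧ (q : ℕ∞) ≤ C.encard := by
    cases q with
    | zero => exact ⟨∅, K.empty_subset, Set.pairwise_empty _, by simp⟩
    | succ k =>
      have hlt : (k : ℕ∞) < packingNumber K d r :=
        lt_of_lt_of_le (by exact_mod_cast k.lt_succ_self) h
      simp only [packingNumber, lt_iSup_iff] at hlt
      obtain ⟨C, hCK, hsep, hk⟩ := hlt
      exact ⟨C, hCK, hsep, by exact_mod_cast Order.add_one_le_of_lt hk⟩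
  obtain ⟨t, htC, ht⟩ := Set.exists_subset_encard_eq hq
  have hfin : t.Finite := Set.finite_of_encard_eq_coe ht
  refine ⟨hfin.toFinset, by simpa using htC.trans hCK, by simpa using hsep.mono htC, ?_⟩
  exact_mod_cast hfin.encard_eq_coe_toFinset_card.symm.trans ht

theorem packingNumber_le_of_forall_finset {B : ℕ}
    (h : ∀ t : Finset X, ↑t ⊆ K → ((t : Set X).Pairwise fun x y => r < d x y) → t.card ≤ B) :
    packingNumber K d r ≤ B := by
  by_contra! hlt
  obtain ⟨t, htK, hsep, ht⟩ :=
    exists_finset_of_le_packingNumber (q := B + 1) (by exact_mod_cast Order.add_one_le_of_lt hlt)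
  have := h t htK hsep
  omega

theorem packingNumber_le_of_mapsTo {φ : X → Y} (hφ : Set.MapsTo φ K K')
    (hself : ∀ y ∈ K', d' y y ≤ r')
    (hd : ∀ x ∈ K, ∀ y ∈ K, r < d x y → r' < d' (φ x) (φ y)) :
    packingNumber K d r ≤ packingNumber K' d' r' := by
  refine iSup_le fun C => iSup₂_le fun hCK hC => ?_
  have hsep : ∀ x ∈ C, ∀ y ∈ C, x ≠ y → r' < d' (φ x) (φ y) := fun x hx y hy hxy =>
    hd x (hCK hx) y (hCK hy) (hC hx hy hxy)
  have hinj : Set.InjOn φ C := fun x hx y hy hxy => by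
    by_contra hne
    exact (hsep x hx y hy hne).not_ge (hxy ▸ hself _ (hφ (hCK hx)))
  rw [← hinj.encard_image]
  exact encard_le_packingNumber (hφ.mono_left hCK).image_subset
    (hinj.pairwise_image.2 fun x hx y hy hxy => hsep x hx y hy hxy)

theorem card_le_packingNumber_mul [DecidableRel fun x y => d x y ≤ r] {T : Finset X} {B : ℕ}
    (hself : ∀ x, d x x ≤ r) (hcomm : ∀ x y, d x y = d y x)
    (hB : ∀ y ∈ T, (T.filter fun x => d x y ≤ r).card ≤ B) :
    (T.card : ℕ∞) ≤ packingNumber (T : Set X) d r * B := by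
  classical
  obtain ⟨C, hCT, hsep, hcov⟩ := exists_maximal_separated hself hcomm (T : Set X)
  lift C to Finset X using T.finite_toSet.subset hCT
  have hunion : T ⊆ C.biUnion fun y => T.filter fun x => d x y ≤ r := fun x hx => by
    obtain ⟨y, hy, hxy⟩ := hcov x hx
    exact Finset.mem_biUnion.2 ⟨y, hy, Finset.mem_filter.2 ⟨hx, hxy⟩⟩
  have hcard : T.card ≤ C.card * B := (Finset.card_le_card hunion).trans
    (Finset.card_biUnion_le_card_mul _ _ _ fun y hy => hB y (hCT hy))
  calc (T.card : ℕ∞) ≤ C.card * B := by exact_mod_cast hcard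
    _ ≤ packingNumber (T : Set X) d r * B := by
      gcongr
      rw [← Set.encard_coe_eq_coe_finsetCard]
      exact encard_le_packingNumber hCT hsep

end Packing

section Volume

variable {F : Type*} [NormedAddCommGroup F] [NormedSpace ℝ F] [FiniteDimensional ℝ F] {r : ℝ}

open Metric Module

theorem card_mul_pow_le_of_separated_closedBall (hr : 0 < r) (t : Finset F)
    (ht : ↑t ⊆ closedBall (0 : F) 1) (hsep : (t : Set F).Pairwise fun x y => r < dist x y) :
    t.card * (r / 2) ^ finrank ℝ F ≤ (1 + r / 2) ^ finrank ℝ F := by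
  borelize F
  let μ : Measure F := Measure.addHaar
  have hdisj : (t : Set F).PairwiseDisjoint fun x => ball x (r / 2) := fun x hx y hy hxy =>
    ball_disjoint_ball (by linarith [hsep hx hy hxy])
  have hsub : (⋃ x ∈ t, ball x (r / 2)) ⊆ ball (0 : F) (1 + r / 2) :=
    Set.iUnion₂_subset fun x hx => ball_subset_ball' (by linarith [mem_closedBall.1 (ht hx)])
  have h := measure_mono (μ := μ) hsub
  rw [measure_biUnion_finset hdisj fun _ _ => measurableSet_ball,
    Measure.addHaar_ball_of_pos _ _ (by positivity)] at h
  simp_rw [Measure.addHaar_ball_of_pos μ _ (half_pos hr)] at h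
  rw [Finset.sum_const, nsmul_eq_mul, ← mul_assoc, ENNReal.mul_le_mul_iff_left
    (measure_ball_pos μ _ one_pos).ne' measure_ball_lt_top.ne, ← ENNReal.ofReal_natCast,
    ← ENNReal.ofReal_mul (by positivity), ENNReal.ofReal_le_ofReal_iff (by positivity)] at h
  exact h

theorem packingNumber_closedBall_le (hr : 0 < r) :
    packingNumber (closedBall (0 : F) 1) dist r ≤ ⌊(1 + 2 / r) ^ finrank ℝ F⌋₊ := by
  refine packingNumber_le_of_forall_finset fun t ht hsep => Nat.le_floor ?_
  have h := card_mul_pow_le_of_separated_closedBall hr t ht hsep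
  rw [← le_div_iff₀ (by positivity), ← div_pow] at h
  convert h using 2
  field_simp
  ring

theorem le_coveringNumber_closedBall (hr : 0 < r) {q : ℕ}
    (hq : (q : ℝ) ≤ (1 / r) ^ finrank ℝ F) :
    q ≤ coveringNumber (closedBall (0 : F) 1) dist r := by
  borelize F
  let μ : Measure F := Measure.addHaar
  refine le_iInf₂ fun C _ => le_iInf fun hcov => ?_
  obtain hC | hC := C.finite_or_infinite.symm
  · simp [hC.encard_eq]
  lift C to Finset F using hC
  have hsub : closedBall (0 : F) 1 ⊆ ⋃ x ∈ C, closedBall x r := fun x hx => by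
    obtain ⟨y, hy, hxy⟩ := hcov x hx
    exact Set.mem_biUnion hy hxy
  have h := (measure_mono (μ := μ) hsub).trans (measure_biUnion_finset_le C _)
  rw [Measure.addHaar_closedBall _ _ zero_le_one] at h
  simp_rw [Measure.addHaar_closedBall μ _ hr.le] at h
  rw [Finset.sum_const, nsmul_eq_mul, ← mul_assoc, ENNReal.mul_le_mul_iff_left
    (measure_ball_pos μ _ one_pos).ne' measure_ball_lt_top.ne, ← ENNReal.ofReal_natCast,
    ← ENNReal.ofReal_mul (by positivity), ENNReal.ofReal_le_ofReal_iff (by positivity),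
    one_pow] at h
  rw [Set.encard_coe_eq_coe_finsetCard]
  have hqC : (q : ℝ) ≤ C.card := hq.trans (by
    rwa [one_div, inv_pow, inv_le_iff_one_le_mul₀ (by positivity)])
  exact_mod_cast hqC

end Volume

/-! ### The trace norm -/

section TraceNorm

open scoped Matrix.Norms.Frobenius

theorem frobenius_norm_sq {m n : Type*} [Fintype m] [Fintype n] (A : Matrix m n ℂ) :
    ‖A‖ ^ 2 = ∑ i, ∑ j, ‖A i j‖ ^ 2 := by
  rw [frobenius_norm_def, ← Real.sqrt_eq_rpow, Real.sq_sqrt (by positivity)]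
  simp only [Real.rpow_two]

theorem trace_conjTranspose_mul_self {m n : Type*} [Fintype m] [Fintype n] (A : Matrix m n ℂ) :
    (Aᴴ * A).trace = (‖A‖ ^ 2 : ℝ) := by
  rw [frobenius_norm_sq, Finset.sum_comm]
  simp only [trace, diag_apply, mul_apply, conjTranspose_apply, Complex.ofReal_sum]
  refine Finset.sum_congr rfl fun j _ => Finset.sum_congr rfl fun i _ => ?_
  rw [Complex.ofReal_pow, ← Complex.conj_mul']
  rfl

variable {ι : Type*} [Fintype ι] [DecidableEq ι]

theorem inner_toEuclideanLin_self_eq_sum {B : Matrix ι ι ℂ} (hB : B.IsHermitian)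
    (x : EuclideanSpace ℂ ι) :
    inner ℂ x (toEuclideanLin B x) =
      ∑ j, (hB.eigenvalues j * ‖inner ℂ (hB.eigenvectorBasis j) x‖ ^ 2 : ℂ) := by
  rw [← hB.eigenvectorBasis.sum_inner_mul_inner]
  refine Finset.sum_congr rfl fun j _ => ?_
  have hv : toEuclideanLin B (hB.eigenvectorBasis j) =
      (hB.eigenvalues j : ℂ) • hB.eigenvectorBasis j :=
    (WithLp.equiv 2 _).injective (by simpa using hB.mulVec_eigenvectorBasis j)
  rw [← isSymmetric_toEuclideanLin_iff.2 hB, hv, inner_smul_left, Complex.conj_ofReal,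
    mul_left_comm, ← inner_conj_symm x, Complex.conj_mul']

theorem sum_norm_inner_le_sum_abs_eigenvalues {B : Matrix ι ι ℂ} (hB : B.IsHermitian)
    (u : OrthonormalBasis ι ℂ (EuclideanSpace ℂ ι)) :
    ∑ i, ‖inner ℂ (u i) (toEuclideanLin B (u i))‖ ≤ ∑ j, |hB.eigenvalues j| := by
  calc ∑ i, ‖inner ℂ (u i) (toEuclideanLin B (u i))‖
      ≤ ∑ i, ∑ j, |hB.eigenvalues j| * ‖inner ℂ (hB.eigenvectorBasis j) (u i)‖ ^ 2 := by
        refine Finset.sum_le_sum fun i _ => ?_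
        rw [inner_toEuclideanLin_self_eq_sum hB]
        exact (norm_sum_le _ _).trans (Finset.sum_le_sum fun j _ => by simp)
    _ = ∑ j, |hB.eigenvalues j| := by
        rw [Finset.sum_comm]
        refine Finset.sum_congr rfl fun j _ => ?_
        rw [← Finset.mul_sum, u.sum_sq_norm_inner_left, hB.eigenvectorBasis.norm_eq_one,
          one_pow, mul_one]

theorem exists_sum_abs_eigenvalues_eq {A : Matrix ι ι ℂ} (hA : A.IsHermitian) :
    ∃ u : OrthonormalBasis ι ℂ (EuclideanSpace ℂ ι),
      ∑ i, |hA.eigenvalues i| = ∑ i, ‖inner ℂ (u i) (toEuclideanLin A (u i))‖ := by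
  refine ⟨hA.eigenvectorBasis, Finset.sum_congr rfl fun i _ => ?_⟩
  rw [inner_toEuclideanLin_self_eq_sum hA, Finset.sum_eq_single i]
  · simp [hA.eigenvectorBasis.norm_eq_one]
  · intro j _ hj
    simp [hA.eigenvectorBasis.inner_eq_zero hj]
  · simp

/-- The trace norm of Hermitian matrices, encoded as the sum of the absolute values of the
eigenvalues. It is a real seminorm because it is the largest value of `∑ |⟨uᵢ, A uᵢ⟩|` over all
orthonormal bases `u`. -/
def traceNorm : Seminorm ℝ (selfAdjoint (Matrix ι ι ℂ)) :=
  Seminorm.ofSMulLE (fun A => ∑ i, |(isHermitian_iff_isSelfAdjoint.2 A.2).eigenvalues i|)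
    (by
      obtain ⟨u, hu⟩ := exists_sum_abs_eigenvalues_eq
        (isHermitian_iff_isSelfAdjoint.2 (0 : selfAdjoint (Matrix ι ι ℂ)).2)
      rw [hu]
      simp)
    (fun A B => by
      obtain ⟨u, hu⟩ := exists_sum_abs_eigenvalues_eq (isHermitian_iff_isSelfAdjoint.2 (A + B).2)
      rw [hu]
      refine le_trans ?_ (add_le_add (sum_norm_inner_le_sum_abs_eigenvalues _ u)
        (sum_norm_inner_le_sum_abs_eigenvalues _ u))
      rw [← Finset.sum_add_distrib]
      refine Finset.sum_le_sum fun i _ => ?_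
      rw [AddSubgroup.coe_add, map_add, LinearMap.add_apply, inner_add_right]
      exact norm_add_le _ _)
    (fun r A => by
      obtain ⟨u, hu⟩ := exists_sum_abs_eigenvalues_eq (isHermitian_iff_isSelfAdjoint.2 (r • A).2)
      rw [hu]
      refine le_trans (le_of_eq ?_) (mul_le_mul_of_nonneg_left
        (sum_norm_inner_le_sum_abs_eigenvalues _ u) (norm_nonneg r))
      rw [Finset.mul_sum]
      refine Finset.sum_congr rfl fun i _ => ?_
      rw [selfAdjoint.val_smul, ← Complex.coe_smul, map_smul, LinearMap.smul_apply,
        inner_smul_right, norm_mul, Complex.norm_real])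

theorem sum_eigenvalues_sq {A : Matrix ι ι ℂ} (hA : A.IsHermitian) :
    ∑ i, hA.eigenvalues i ^ 2 = ‖A‖ ^ 2 := by
  have h : Aᴴ * A = Unitary.conjStarAlgAut ℂ (Matrix ι ι ℂ) hA.eigenvectorUnitary
      (diagonal (RCLike.ofReal ∘ hA.eigenvalues) * diagonal (RCLike.ofReal ∘ hA.eigenvalues)) := by
    rw [map_mul, ← hA.spectral_theorem, hA.eq]
  apply Complex.ofReal_injective
  rw [← trace_conjTranspose_mul_self, h, Unitary.conjStarAlgAut_apply, trace_mul_cycle]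
  simp [trace_diagonal, pow_two]

theorem frobenius_norm_le_traceNorm (A : selfAdjoint (Matrix ι ι ℂ)) : ‖A.1‖ ≤ traceNorm A := by
  have hA := isHermitian_iff_isSelfAdjoint.2 A.2
  have h := Finset.sum_sq_le_sq_sum_of_nonneg (s := Finset.univ)
    (f := fun i => |hA.eigenvalues i|) fun _ _ => abs_nonneg _
  simp only [sq_abs, sum_eigenvalues_sq] at h
  exact (sq_le_sq₀ (norm_nonneg _) (apply_nonneg _ _)).1 h

theorem traceNorm_sq_le_rank_mul (A : selfAdjoint (Matrix ι ι ℂ)) :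
    traceNorm A ^ 2 ≤ A.1.rank * ‖A.1‖ ^ 2 := by
  have hA := isHermitian_iff_isSelfAdjoint.2 A.2
  have h := sq_sum_le_card_mul_sum_sq (s := Finset.univ.filter fun i => hA.eigenvalues i ≠ 0)
    (f := fun i => |hA.eigenvalues i|)
  rw [Finset.sum_filter_of_ne (fun i _ hi => by simpa using hi),
    Finset.sum_filter_of_ne (fun i _ hi => by simpa using hi)] at h
  rw [hA.rank_eq_card_non_zero_eigs, Fintype.card_subtype, ← sum_eigenvalues_sq hA]
  simp only [sq_abs] at h
  exact h

theorem traceNorm_le_sqrt_card_mul (A : selfAdjoint (Matrix ι ι ℂ)) :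
    traceNorm A ≤ √(Fintype.card ι) * ‖A.1‖ := by
  refine (sq_le_sq₀ (apply_nonneg _ _) (mul_nonneg (Real.sqrt_nonneg _) (norm_nonneg _))).1 ?_
  rw [mul_pow, Real.sq_sqrt (by positivity)]
  refine (traceNorm_sq_le_rank_mul A).trans ?_
  gcongr
  exact A.1.rank_le_card_width

/-- The positive and the negative eigenvalues carry the same mass, hence no eigenvalue exceeds half
of the trace norm in absolute value. -/
theorem two_mul_frobenius_norm_sq_le_traceNorm_sq {A : selfAdjoint (Matrix ι ι ℂ)}
    (h0 : A.1.trace = 0) : 2 * ‖A.1‖ ^ 2 ≤ traceNorm A ^ 2 := by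
  have hA := isHermitian_iff_isSelfAdjoint.2 A.2
  have hnorm : traceNorm A = ∑ i, |hA.eigenvalues i| := rfl
  have hsum : ∑ i, hA.eigenvalues i = 0 := by
    have := hA.trace_eq_sum_eigenvalues
    rw [h0] at this
    exact Complex.ofReal_injective (by simpa using this.symm)
  have hle : ∀ i, 2 * |hA.eigenvalues i| ≤ traceNorm A := fun i => by
    rw [← Finset.add_sum_erase _ _ (Finset.mem_univ i), add_eq_zero_iff_eq_neg] at hsum
    have habs := Finset.abs_sum_le_sum_abs hA.eigenvalues (Finset.univ.erase i)
    rw [hnorm, ← Finset.add_sum_erase _ _ (Finset.mem_univ i), two_mul]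
    gcongr
    rwa [hsum, abs_neg]
  calc 2 * ‖A.1‖ ^ 2 = ∑ i, 2 * |hA.eigenvalues i| * |hA.eigenvalues i| := by
        rw [← sum_eigenvalues_sq hA, Finset.mul_sum]
        refine Finset.sum_congr rfl fun i _ => ?_
        rw [mul_assoc, abs_mul_abs_self, pow_two]
    _ ≤ ∑ i, traceNorm A * |hA.eigenvalues i| := by gcongr; exact hle _
    _ = traceNorm A ^ 2 := by rw [← Finset.mul_sum, ← hnorm, pow_two]

theorem continuous_traceNorm :
    Continuous (traceNorm : Seminorm ℝ (selfAdjoint (Matrix ι ι ℂ))) := by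
  refine Seminorm.continuous_of_continuousAt_zero ?_
  rw [ContinuousAt, map_zero]
  refine squeeze_zero (apply_nonneg _) traceNorm_le_sqrt_card_mul ?_
  have hnorm : Continuous fun A : selfAdjoint (Matrix ι ι ℂ) => √(Fintype.card ι) * ‖A.1‖ :=
    continuous_const.mul continuous_subtype_val.norm
  simpa using hnorm.tendsto 0

end TraceNorm

/-! ### The trace distance -/

section TraceDist

instance secondCountableTopology_matrix {m n : Type*} [Countable m] [Countable n] :
    SecondCountableTopology (Matrix m n ℂ) :=
  inferInstanceAs (SecondCountableTopology (m → n → ℂ))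

variable {ι : Type*} [Fintype ι]

instance secondCountableTopology_densityMatrix : SecondCountableTopology (DensityMatrix ι) :=
  TopologicalSpace.Subtype.secondCountableTopology _

/-- A state as a Hermitian matrix, so that the trace norm applies to differences of states. -/
def DensityMatrix.toSelfAdjoint (ρ : DensityMatrix ι) : selfAdjoint (Matrix ι ι ℂ) :=
  ⟨ρ.1, isHermitian_iff_isSelfAdjoint.1 ρ.2.1.isHermitian⟩

variable [DecidableEq ι]

theorem traceDist_eq_traceNorm_sub (ρ σ : DensityMatrix ι) :
    traceDist ρ σ = 1 / 2 * traceNorm (ρ.toSelfAdjoint - σ.toSelfAdjoint) := rfl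

theorem traceDist_nonneg (ρ σ : DensityMatrix ι) : 0 ≤ traceDist ρ σ := by
  rw [traceDist_eq_traceNorm_sub]
  positivity

theorem traceDist_self (ρ : DensityMatrix ι) : traceDist ρ ρ = 0 := by
  rw [traceDist_eq_traceNorm_sub, sub_self, map_zero, mul_zero]

theorem traceDist_comm (ρ σ : DensityMatrix ι) : traceDist ρ σ = traceDist σ ρ := by
  rw [traceDist_eq_traceNorm_sub, map_sub_rev, ← traceDist_eq_traceNorm_sub]

theorem traceDist_triangle (ρ σ τ : DensityMatrix ι) :
    traceDist ρ τ ≤ traceDist ρ σ + traceDist σ τ := by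
  simp only [traceDist_eq_traceNorm_sub, ← mul_add]
  gcongr
  exact le_map_sub_add_map_sub traceNorm _ _ _

theorem traceNorm_densityMatrix (ρ : DensityMatrix ι) : traceNorm ρ.toSelfAdjoint = 1 := by
  have hsum : ∑ i, ρ.2.1.isHermitian.eigenvalues i = 1 := by
    have := ρ.2.1.isHermitian.trace_eq_sum_eigenvalues.symm.trans ρ.2.2
    exact Complex.ofReal_injective (by simpa using this)
  rw [← hsum]
  exact Finset.sum_congr rfl fun i _ => abs_of_nonneg (ρ.2.1.eigenvalues_nonneg i)

theorem traceDist_le_one (ρ σ : DensityMatrix ι) : traceDist ρ σ ≤ 1 := by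
  have h := map_sub_le_add traceNorm ρ.toSelfAdjoint σ.toSelfAdjoint
  rw [traceNorm_densityMatrix, traceNorm_densityMatrix] at h
  rw [traceDist_eq_traceNorm_sub]
  linarith

theorem continuous_traceDist :
    Continuous fun p : DensityMatrix ι × DensityMatrix ι => traceDist p.1 p.2 := by
  have hsub : Continuous fun p : DensityMatrix ι × DensityMatrix ι =>
      p.1.toSelfAdjoint - p.2.toSelfAdjoint :=
    ((continuous_subtype_val.comp continuous_fst).sub
      (continuous_subtype_val.comp continuous_snd)).subtype_mk _
  simp only [traceDist_eq_traceNorm_sub]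
  exact continuous_const.mul (continuous_traceNorm.comp hsub)

open scoped Matrix.Norms.Frobenius in
theorem exists_forall_coveringNumber_traceDist_le {η : ℝ} (hη : 0 < η) :
    ∃ B : ℕ, ∀ K : Set (DensityMatrix ι), coveringNumber K traceDist η ≤ B := by
  let s : ℝ := η / (√(Fintype.card ι) + 1)
  have hs : 0 < s := by positivity
  have hball (ρ : DensityMatrix ι) : ρ.1 ∈ Metric.closedBall (0 : Matrix ι ι ℂ) 1 := by
    rw [mem_closedBall_zero_iff]
    exact (frobenius_norm_le_traceNorm ρ.toSelfAdjoint).trans_eq (traceNorm_densityMatrix ρ)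
  have hdist (ρ σ : DensityMatrix ι) (h : η < traceDist ρ σ) : s < dist ρ.1 σ.1 := by
    have hle := traceNorm_le_sqrt_card_mul (ρ.toSelfAdjoint - σ.toSelfAdjoint)
    rw [traceDist_eq_traceNorm_sub] at h
    rw [div_lt_iff₀ (by positivity), dist_eq_norm]
    change _ ≤ _ * ‖ρ.1 - σ.1‖ at hle
    linarith [norm_nonneg (ρ.1 - σ.1)]
  refine ⟨_, fun K =>
    (coveringNumber_le_packingNumber (fun ρ => (traceDist_self ρ).trans_le hη.le)
      traceDist_comm).trans <|
    (packingNumber_le_of_mapsTo (fun ρ _ => hball ρ) (fun A _ => (dist_self A).trans_le hs.le)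
      fun ρ _ σ _ => hdist ρ σ).trans (packingNumber_closedBall_le hs)⟩

end TraceDist

section RmsDist

variable {ι κ : Type*} [Fintype ι] [Fintype κ] [DecidableEq κ] {P : Measure (DensityMatrix ι)}
  {f g h : DensityMatrix ι → DensityMatrix κ}

theorem rmsDist_self : rmsDist P f f = 0 := by
  simp [rmsDist, traceDist_self]

theorem rmsDist_comm : rmsDist P f g = rmsDist P g f := by
  simp only [rmsDist, traceDist_comm (f _) (g _)]

variable [IsFiniteMeasure P]

theorem memLp_traceDist_comp (hf : Measurable f) (hg : Measurable g) :
    MemLp (fun ρ => traceDist (f ρ) (g ρ)) 2 P := by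
  have hpair : Measurable fun p : DensityMatrix κ × DensityMatrix κ => traceDist p.1 p.2 :=
    continuous_traceDist.measurable
  have hmeas : Measurable fun ρ => traceDist (f ρ) (g ρ) :=
    hpair.comp (f := fun ρ => (f ρ, g ρ)) (hf.prodMk hg)
  refine MemLp.of_bound hmeas.aestronglyMeasurable 1 (.of_forall fun ρ => ?_)
  rw [Real.norm_of_nonneg (traceDist_nonneg _ _)]
  exact traceDist_le_one _ _

theorem rmsDist_eq_lpNorm (hf : Measurable f) (hg : Measurable g) :
    rmsDist P f g = lpNorm (fun ρ => traceDist (f ρ) (g ρ)) 2 P := by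
  rw [lpNorm_eq_integral_norm_rpow_toReal two_ne_zero ENNReal.ofNat_ne_top
    (memLp_traceDist_comp hf hg).aestronglyMeasurable, rmsDist, Real.sqrt_eq_rpow]
  simp

theorem rmsDist_triangle (hf : Measurable f) (hg : Measurable g) (hh : Measurable h) :
    rmsDist P f h ≤ rmsDist P f g + rmsDist P g h := by
  have hfg := memLp_traceDist_comp (P := P) hf hg
  have hgh := memLp_traceDist_comp (P := P) hg hh
  rw [rmsDist_eq_lpNorm hf hg, rmsDist_eq_lpNorm hg hh, rmsDist_eq_lpNorm hf hh]
  refine (lpNorm_mono_real (hfg.add hgh) fun ρ => ?_).trans (lpNorm_add_le hfg one_le_two)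
  rw [Real.norm_of_nonneg (traceDist_nonneg _ _)]
  exact traceDist_triangle _ _ _

end RmsDist

/-! ### Counting transcripts -/

theorem Learner.exists_finset_forall_data_mem {Ω X Y G : Type*} (H : Learner Ω X Y G) (ω : Ω)
    {C : X → Finset Y} {q : ℕ} (hC : ∀ x, (C x).card ≤ q) (N : ℕ) :
    ∃ D : Finset (List (X × Y)), D.card ≤ q ^ N ∧
      ∀ g : ℕ → X → Y, (∀ k x, g k x ∈ C x) → H.data g ω N ∈ D := by
  classical
  induction N with
  | zero => exact ⟨{[]}, by simp, fun g _ => by simp [Learner.data]⟩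
  | succ k ih =>
    obtain ⟨D, hD, hmem⟩ := ih
    refine ⟨D.biUnion fun l => (C (H.query ω l)).image fun y => l ++ [(H.query ω l, y)],
      ?_, fun g hg => ?_⟩
    · calc _ ≤ D.card * q := Finset.card_biUnion_le_card_mul _ _ _ fun l _ =>
            Finset.card_image_le.trans (hC _)
        _ ≤ q ^ (k + 1) := by
            rw [pow_succ]
            gcongr
    · exact Finset.mem_biUnion.2 ⟨_, hmem g hg, Finset.mem_image_of_mem _ (hg k _)⟩

theorem sum_measure_le_of_card_filter_le {Ω T : Type*} [MeasurableSpace Ω] {μ : Measure Ω}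
    [IsProbabilityMeasure μ] (t : Finset T) {A : T → Set Ω} (hA : ∀ i ∈ t, MeasurableSet (A i))
    {B : ℕ} [∀ ω, DecidablePred fun i => ω ∈ A i]
    (h : ∀ ω, (t.filter fun i => ω ∈ A i).card ≤ B) : ∑ i ∈ t, μ (A i) ≤ B := by
  have hcount (ω : Ω) : ∑ i ∈ t, (A i).indicator (1 : Ω → ENNReal) ω ≤ B := by
    simp only [Set.indicator_apply, Pi.one_apply, Finset.sum_boole]
    exact_mod_cast h ω
  calc ∑ i ∈ t, μ (A i) = ∑ i ∈ t, ∫⁻ ω, (A i).indicator 1 ω ∂μ :=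
        Finset.sum_congr rfl fun i hi => (lintegral_indicator_one (hA i hi)).symm
    _ = ∫⁻ ω, ∑ i ∈ t, (A i).indicator 1 ω ∂μ :=
        (lintegral_finsetSum _ fun i hi => measurable_one.indicator (hA i hi)).symm
    _ ≤ ∫⁻ _, (B : ENNReal) ∂μ := lintegral_mono hcount
    _ = B := by simp

theorem half_log_le_mul_log_of_two_mul_le {m q N : ℕ} (h : 2 * m ≤ 3 * q ^ N) :
    1 / 2 * Real.log m ≤ N * Real.log q := by
  obtain rfl | hm := m.eq_zero_or_pos
  · have := Real.log_natCast_nonneg q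
    simp only [Nat.cast_zero, Real.log_zero, mul_zero]
    positivity
  have hsq : m ≤ (q ^ N) ^ 2 := by
    obtain hlt | hge := Nat.lt_or_ge (q ^ N) 2
    · interval_cases q ^ N <;> omega
    · nlinarith
  have hlog : Real.log m ≤ Real.log (((q : ℝ) ^ N) ^ 2) :=
    Real.log_le_log (by exact_mod_cast hm) (by exact_mod_cast hsq)
  rw [Real.log_pow, Real.log_pow, Nat.cast_ofNat] at hlog
  linarith

section Learning

variable {G Ω ι κ : Type*} [MeasurableSpace Ω] [Fintype ι] [Fintype κ] [DecidableEq κ]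
  {μ : Measure Ω} {f : G → DensityMatrix ι → DensityMatrix κ} {𝒰 : Set G}
  {S : Set (DensityMatrix ι)} {P : Measure (DensityMatrix ι)} {ε η r : ℝ} {N : ℕ}
  {H : Learner Ω S (DensityMatrix κ) G}

theorem maxCoveringNumber_ne_top (hη : 0 < η) : maxCoveringNumber f 𝒰 S η ≠ ⊤ := by
  obtain ⟨B, hB⟩ := exists_forall_coveringNumber_traceDist_le (ι := κ) hη
  exact ne_top_of_le_ne_top (ENat.natCast_ne_top B) (iSup₂_le fun ρ _ => hB _)

theorem exists_response_menu {q : ℕ} (hq : maxCoveringNumber f 𝒰 S η ≤ q) :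
    ∃ C : S → Finset (DensityMatrix κ), (∀ ρ, (C ρ).card ≤ q) ∧
      ∀ U ∈ 𝒰, ∀ ρ : S, ∃ σ ∈ C ρ, traceDist (f U ρ) σ ≤ η := by
  have hcov (ρ : S) : ∃ C : Finset (DensityMatrix κ), C.card ≤ q ∧
      ∀ U ∈ 𝒰, ∃ σ ∈ C, traceDist (f U ρ) σ ≤ η := by
    obtain ⟨C, -, hC, hcard⟩ :=
      exists_cover_of_coveringNumber_le ((le_iSup₂ ρ.1 ρ.2).trans hq)
    lift C to Finset (DensityMatrix κ) using
      Set.finite_of_encard_le_coe hcard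
    exact ⟨C, by simpa using hcard, fun U hU => hC _ ⟨U, hU, rfl⟩⟩
  choose C hcard hC using hcov
  exact ⟨C, hcard, fun U hU ρ => hC ρ U hU⟩

variable [IsProbabilityMeasure μ] [IsFiniteMeasure P]

/- The responses are rounded to the menus `C ρ`, so at most `q ^ N` transcripts occur for each seed.
Targets more than `2 * ε` apart need different transcripts, and each one succeeds for two thirds of
the seeds. -/
theorem Learns.two_mul_card_le (hf : ∀ V, Measurable (f V)) (hL : Learns μ f 𝒰 S P ε η N H)
    {q : ℕ} {C : S → Finset (DensityMatrix κ)} (hC : ∀ ρ, (C ρ).card ≤ q)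
    (hcov : ∀ U ∈ 𝒰, ∀ ρ : S, ∃ σ ∈ C ρ, traceDist (f U ρ) σ ≤ η)
    {t : Finset (DensityMatrix ι → DensityMatrix κ)} (ht : ↑t ⊆ f '' 𝒰)
    (hsep : (t : Set (DensityMatrix ι → DensityMatrix κ)).Pairwise fun g h =>
      2 * ε < rmsDist P g h) :
    2 * t.card ≤ 3 * q ^ N := by
  classical
  choose U hU hUf using fun φ : t => ht φ.2
  choose g hgC hg using fun φ : t => hcov (U φ) (hU φ)
  choose A hA hAμ hout using fun φ : t =>
    hL (U φ) (hU φ) (fun _ => g φ) fun _ ρ => (traceDist_comm _ _).trans_le (hg φ ρ)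
  have hdata_inj {ω : Ω} {φ ψ : t} (hφ : ω ∈ A φ) (hψ : ω ∈ A ψ)
      (hdata : H.data (fun _ => g φ) ω N = H.data (fun _ => g ψ) ω N) : φ = ψ := by
    by_contra hne
    have hφ' := hout φ ω hφ
    have hψ' := hout ψ ω hψ
    rw [hdata, rmsDist_comm] at hφ'
    have hfar := hsep φ.2 ψ.2 fun h => hne (Subtype.ext h)
    rw [← hUf φ, ← hUf ψ] at hfar
    linarith [rmsDist_triangle (P := P) (hf (U φ))
      (hf (H.output ω (H.data (fun _ => g ψ) ω N))) (hf (U ψ))]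
  have hcount (ω : Ω) : (Finset.univ.filter fun φ : t => ω ∈ A φ).card ≤ q ^ N := by
    obtain ⟨D, hD, hmem⟩ := H.exists_finset_forall_data_mem ω hC N
    refine (Finset.card_le_card_of_injOn (fun φ => H.data (fun _ => g φ) ω N)
      (fun φ _ => hmem _ fun _ => hgC φ) fun φ hφ ψ hψ => ?_).trans hD
    simp only [Finset.coe_filter, Finset.mem_univ, true_and, Set.mem_ofPred_eq] at hφ hψ
    exact hdata_inj hφ hψ
  have hsum : ∑ _φ : t, (2 / 3 : ENNReal) ≤ (q ^ N : ℕ) :=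
    (Finset.sum_le_sum fun φ _ => hAμ φ).trans
      (sum_measure_le_of_card_filter_le Finset.univ (fun φ _ => hA φ) hcount)
  rw [Finset.sum_const, Finset.card_univ, Fintype.card_coe, nsmul_eq_mul, ← mul_div_assoc,
    ENNReal.div_le_iff (by norm_num) (by norm_num)] at hsum
  have : t.card * 2 ≤ q ^ N * 3 := by exact_mod_cast hsum
  omega

theorem Learns.log_packingNumber_le (hf : ∀ V, Measurable (f V)) (hη : 0 < η)
    (hr : 2 * ε ≤ r) (hL : Learns μ f 𝒰 S P ε η N H) :
    packingNumber (f '' 𝒰) (rmsDist P) r ≠ ⊤ ∧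
      1 / 2 * Real.log (packingNumber (f '' 𝒰) (rmsDist P) r).toNat ≤
        N * Real.log (maxCoveringNumber f 𝒰 S η).toNat := by
  set q := (maxCoveringNumber f 𝒰 S η).toNat
  obtain ⟨C, hC, hcov⟩ := exists_response_menu (f := f) (𝒰 := 𝒰) (S := S) (q := q)
    (ENat.natCast_toNat (maxCoveringNumber_ne_top hη)).ge
  have hle : packingNumber (f '' 𝒰) (rmsDist P) r ≤ (3 * q ^ N / 2 : ℕ) :=
    packingNumber_le_of_forall_finset fun t ht hsep => by
      have := hL.two_mul_card_le hf hC hcov ht (hsep.mono' fun _ _ => hr.trans_lt)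
      omega
  have hfin := ne_top_of_le_ne_top (ENat.natCast_ne_top _) hle
  refine ⟨hfin, half_log_le_mul_log_of_two_mul_le ?_⟩
  rw [← ENat.natCast_toNat hfin] at hle
  have : (packingNumber (f '' 𝒰) (rmsDist P) r).toNat ≤ 3 * q ^ N / 2 := by exact_mod_cast hle
  omega

end Learning

/-! ### Separated unit vectors -/

section Overlap

variable {E : Type*} [NormedAddCommGroup E] [InnerProductSpace ℂ E] {e u v w z : E}

/-- The defect `1 - |⟨u, v⟩|` of the overlap of two unit vectors, which measures how far apart
they are up to a phase. -/
def overlapDefect (u v : E) : ℝ := 1 - ‖(inner ℂ u v : ℂ)‖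

theorem overlapDefect_self (hu : ‖u‖ = 1) : overlapDefect u u = 0 := by
  simp [overlapDefect, inner_self_eq_norm_sq_to_K, hu]

theorem overlapDefect_comm (u v : E) : overlapDefect u v = overlapDefect v u := by
  rw [overlapDefect, overlapDefect, norm_inner_symm]

theorem overlapDefect_nonneg (hu : ‖u‖ = 1) (hv : ‖v‖ = 1) : 0 ≤ overlapDefect u v := by
  have := norm_inner_le_norm (𝕜 := ℂ) u v
  rw [hu, hv, one_mul] at this
  exact sub_nonneg.2 this

theorem two_mul_overlapDefect_le_norm_sub_sq (hu : ‖u‖ = 1) (hv : ‖v‖ = 1) :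
    2 * overlapDefect u v ≤ ‖u - v‖ ^ 2 := by
  have hre := (inner ℂ u v).re_le_norm
  have hsub := norm_sub_sq (𝕜 := ℂ) u v
  rw [hu, hv] at hsub
  simp only [RCLike.re_eq_complex_re] at hsub
  rw [hsub, overlapDefect]
  linarith

theorem exists_norm_smul_sub_sq_eq (hu : ‖u‖ = 1) (hv : ‖v‖ = 1) :
    ∃ c : ℂ, ‖c‖ = 1 ∧ ‖c • u - v‖ ^ 2 = 2 * overlapDefect u v := by
  obtain ⟨c, hc, hcuv⟩ := RCLike.exists_norm_eq_mul_self (inner ℂ u v : ℂ)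
  refine ⟨star c, by simpa using hc, ?_⟩
  have hinner : inner ℂ (star c • u) v = (‖(inner ℂ u v : ℂ)‖ : ℂ) := by
    rw [inner_smul_left, Complex.star_def, Complex.conj_conj]
    exact hcuv.symm
  rw [norm_sub_sq (𝕜 := ℂ), hinner, norm_smul, norm_star, hc, hu, hv]
  simp only [RCLike.re_eq_complex_re, Complex.ofReal_re, overlapDefect]
  ring

theorem overlapDefect_le_two_mul_add (hu : ‖u‖ = 1) (hv : ‖v‖ = 1) (hw : ‖w‖ = 1) :
    overlapDefect u w ≤ 2 * (overlapDefect u v + overlapDefect v w) := by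
  obtain ⟨a, ha, hau⟩ := exists_norm_smul_sub_sq_eq hu hv
  obtain ⟨b, hb, hbw⟩ := exists_norm_smul_sub_sq_eq hw hv
  have hphase : overlapDefect (a • u) (b • w) = overlapDefect u w := by
    simp [overlapDefect, ha, hb]
  have hle := two_mul_overlapDefect_le_norm_sub_sq (u := a • u) (v := b • w)
    (by simp [norm_smul, ha, hu]) (by simp [norm_smul, hb, hw])
  have htri : ‖a • u - b • w‖ ≤ ‖a • u - v‖ + ‖b • w - v‖ := by
    simpa using norm_sub_le (a • u - v) (b • w - v)
  rw [hphase] at hle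
  rw [overlapDefect_comm v w]
  nlinarith [pow_le_pow_left₀ (norm_nonneg _) htri 2, sq_nonneg (‖a • u - v‖ - ‖b • w - v‖)]

theorem norm_add_sq_of_inner_eq_zero (he : ‖e‖ = 1) (hz : inner ℂ e z = 0) :
    ‖e + z‖ ^ 2 = 1 + ‖z‖ ^ 2 := by
  have := norm_add_sq_eq_norm_sq_add_norm_sq_of_inner_eq_zero e z hz
  rw [he] at this
  linarith

theorem norm_sub_sq_le_of_inner_eq_zero (he : ‖e‖ = 1) (hz : inner ℂ e z = 0)
    (hw : inner ℂ e w = 0) :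
    ‖z - w‖ ^ 2 ≤ (‖e + z‖ * ‖e + w‖) ^ 2 - ‖(inner ℂ (e + z) (e + w) : ℂ)‖ ^ 2 := by
  have hinner : inner ℂ (e + z) (e + w) = 1 + inner ℂ z w := by
    have hz' : inner ℂ z e = 0 := inner_eq_zero_symm.1 hz
    rw [inner_add_left, inner_add_right, inner_add_right, hw, hz', inner_self_eq_norm_sq_to_K, he]
    simp
  have hnorm : ‖1 + (inner ℂ z w : ℂ)‖ ^ 2 =
      1 + 2 * (inner ℂ z w : ℂ).re + ‖(inner ℂ z w : ℂ)‖ ^ 2 := by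
    simp only [Complex.sq_norm, Complex.normSq_apply, Complex.add_re, Complex.add_im,
      Complex.one_re, Complex.one_im]
    ring
  have hcs := pow_le_pow_left₀ (norm_nonneg _) (norm_inner_le_norm (𝕜 := ℂ) z w) 2
  have hsub := norm_sub_sq (𝕜 := ℂ) z w
  simp only [RCLike.re_eq_complex_re] at hsub
  rw [mul_pow, norm_add_sq_of_inner_eq_zero he hz, norm_add_sq_of_inner_eq_zero he hw, hinner,
    hnorm, hsub]
  nlinarith

theorem norm_sub_sq_div_le_overlapDefect_normalize (he : ‖e‖ = 1) (hz : inner ℂ e z = 0)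
    (hw : inner ℂ e w = 0) (hz1 : ‖z‖ ≤ 1) (hw1 : ‖w‖ ≤ 1) :
    ‖z - w‖ ^ 2 / 8 ≤
      overlapDefect (NormedSpace.normalize (e + z)) (NormedSpace.normalize (e + w)) := by
  have hdist := norm_sub_sq_le_of_inner_eq_zero he hz hw
  have hcs := norm_inner_le_norm (𝕜 := ℂ) (e + z) (e + w)
  have hdefect : overlapDefect (NormedSpace.normalize (e + z)) (NormedSpace.normalize (e + w)) =
      1 - ‖(inner ℂ (e + z) (e + w) : ℂ)‖ / (‖e + z‖ * ‖e + w‖) := by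
    simp only [overlapDefect, NormedSpace.normalize, inner_smul_left_eq_smul,
      inner_smul_right_eq_smul, norm_smul, norm_inv, norm_norm]
    ring
  set K := ‖e + z‖ * ‖e + w‖ with hK
  set x := ‖(inner ℂ (e + z) (e + w) : ℂ)‖
  have hKsq : K ^ 2 = (1 + ‖z‖ ^ 2) * (1 + ‖w‖ ^ 2) := by
    rw [hK, mul_pow, norm_add_sq_of_inner_eq_zero he hz, norm_add_sq_of_inner_eq_zero he hw]
  have hKsq_le : K ^ 2 ≤ 2 * 2 := by
    rw [hKsq]
    gcongr <;> nlinarith [norm_nonneg z, norm_nonneg w]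
  have hKpos : 0 < K := by
    refine lt_of_pow_lt_pow_left₀ 2 (by positivity) ?_
    rw [hKsq, zero_pow two_ne_zero]
    positivity
  have hKx : (K + x) * K ≤ 8 := by nlinarith
  rw [hdefect, one_sub_div hKpos.ne', div_le_div_iff₀ (by norm_num) hKpos]
  calc ‖z - w‖ ^ 2 * K ≤ (K ^ 2 - x ^ 2) * K := by gcongr
    _ = (K - x) * ((K + x) * K) := by ring
    _ ≤ (K - x) * 8 := mul_le_mul_of_nonneg_left hKx (sub_nonneg.2 hcs)

open Module

theorem finrank_le_finrank_orthogonal_span_range [FiniteDimensional ℂ E] {ι : Type*} [Fintype ι]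
    (u : ι → E) : finrank ℂ E ≤ Fintype.card ι + finrank ℂ (Submodule.span ℂ (Set.range u))ᗮ := by
  have hle : finrank ℂ (Submodule.span ℂ (Set.range u)) ≤ Fintype.card ι :=
    finrank_range_le_card (R := ℂ) u
  have hadd := (Submodule.span ℂ (Set.range u)).finrank_add_finrank_orthogonal
  omega

variable [FiniteDimensional ℂ E] {L q : ℕ} {r : ℝ}

/- Normalizing `e + z`, for a fixed unit vector `e` and `z` in the unit ball of its orthogonal
complement, turns separated points of the ball into separated unit vectors. -/
theorem le_packingNumber_sphere_overlapDefect (hL : L + 1 ≤ finrank ℂ E) (hr : 0 < r)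
    (hr1 : r ≤ 1) (hq : (q : ℝ) ≤ (1 / r) ^ (2 * L)) :
    q ≤ packingNumber (Metric.sphere (0 : E) 1) overlapDefect (r ^ 2 / 8) := by
  have : Nontrivial E := nontrivial_of_finrank_pos (R := ℂ) (by omega)
  obtain ⟨e, he⟩ := exists_norm_eq E zero_le_one
  let W := (Submodule.span ℂ (Set.range fun _ : Unit => e))ᗮ
  have : FiniteDimensional ℝ W := FiniteDimensional.complexToReal W
  have hW : 2 * L ≤ finrank ℝ W := by
    have hdim : finrank ℂ E ≤ 1 + finrank ℂ W :=
      finrank_le_finrank_orthogonal_span_range fun _ : Unit => e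
    rw [finrank_real_of_complex]
    omega
  have heW (z : W) : inner ℂ e (z : E) = 0 :=
    (Submodule.mem_orthogonal _ _).1 z.2 _ (Submodule.subset_span ⟨(), rfl⟩)
  have hball : q ≤ coveringNumber (Metric.closedBall (0 : W) 1) dist r :=
    le_coveringNumber_closedBall hr
      (hq.trans (pow_le_pow_right₀ ((one_le_div₀ hr).2 hr1) hW))
  refine hball.trans <| (coveringNumber_le_packingNumber (fun z => (dist_self z).trans_le hr.le)
    dist_comm).trans <| packingNumber_le_of_mapsTo (φ := fun z : W =>
      NormedSpace.normalize (e + z)) (fun z _ => ?_) (fun w hw => ?_) fun z hz w hw hzw => ?_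
  · rw [mem_sphere_zero_iff_norm, NormedSpace.norm_normalize_eq_one_iff, ← norm_ne_zero_iff,
      ← pow_ne_zero_iff two_ne_zero, norm_add_sq_of_inner_eq_zero he (heW z)]
    positivity
  · rw [overlapDefect_self (mem_sphere_zero_iff_norm.1 hw)]
    positivity
  · refine lt_of_lt_of_le ?_ (norm_sub_sq_div_le_overlapDefect_normalize he (heW z) (heW w)
      (mem_closedBall_zero_iff.1 hz) (mem_closedBall_zero_iff.1 hw))
    rw [dist_eq_norm] at hzw
    change r < ‖(z : E) - w‖ at hzw
    gcongr

theorem le_packingNumber_sphere_orthogonal {ι : Type*} [Fintype ι] (u : ι → E)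
    (hL : Fintype.card ι + L + 1 ≤ finrank ℂ E) (hr : 0 < r) (hr1 : r ≤ 1)
    (hq : (q : ℝ) ≤ (1 / r) ^ (2 * L)) :
    q ≤ packingNumber {w : E | ‖w‖ = 1 ∧ ∀ i, inner ℂ (u i) w = 0} overlapDefect (r ^ 2 / 8) := by
  have hW := finrank_le_finrank_orthogonal_span_range u
  refine (le_packingNumber_sphere_overlapDefect
    (E := (Submodule.span ℂ (Set.range u))ᗮ) (by omega) hr hr1 hq).trans <|
    packingNumber_le_of_mapsTo (φ := Subtype.val) (fun w hw => ?_) (fun w hw => ?_)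
      fun v _ w _ hvw => hvw
  · exact ⟨mem_sphere_zero_iff_norm.1 hw, fun i =>
      (Submodule.mem_orthogonal _ _).1 w.2 _ (Submodule.subset_span ⟨i, rfl⟩)⟩
  · rw [overlapDefect_self hw.1]
    positivity

end Overlap

/-! ### Trees of orthonormal tuples -/

section Tree

variable {α β : Type*} {child : ∀ k, (Fin k → α) → β → α} {k : ℕ}

/-- The branch with labels `x` of the tree in which the children of the node `(a₀, …, aₖ₋₁)` are
the points `child k (a₀, …, aₖ₋₁) b`, one for each label `b`. -/
def treeBranch (child : ∀ k, (Fin k → α) → β → α) : ∀ k, (Fin k → β) → Fin k → α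
  | 0, _ => Fin.elim0
  | k + 1, x =>
      Fin.snoc (treeBranch child k (Fin.init x))
        (child k (treeBranch child k (Fin.init x)) (x (Fin.last k)))

theorem treeBranch_castSucc (x : Fin (k + 1) → β) (i : Fin k) :
    treeBranch child (k + 1) x i.castSucc = treeBranch child k (Fin.init x) i :=
  Fin.snoc_castSucc (α := fun _ => α) _ _ i

theorem treeBranch_last (x : Fin (k + 1) → β) :
    treeBranch child (k + 1) x (Fin.last k) =
      child k (treeBranch child k (Fin.init x)) (x (Fin.last k)) :=
  Fin.snoc_last (α := fun _ => α) _ _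

theorem eq_of_forall_treeBranch_mem {N : Fin k → Set α} {x y : Fin k → β}
    (hN : ∀ (i : Fin k) u b b', child i u b ∈ N i → child i u b' ∈ N i → b = b')
    (hxy : ∀ i, x i = y i ∨ treeBranch child k x i ∈ N i ∧ treeBranch child k y i ∈ N i) :
    x = y := by
  induction k with
  | zero => exact Subsingleton.elim x y
  | succ k ih =>
    have hinit : Fin.init x = Fin.init y := by
      refine ih (N := fun i => N i.castSucc) (fun i => hN i.castSucc) fun i => ?_
      have h := hxy i.castSucc
      rwa [treeBranch_castSucc, treeBranch_castSucc] at h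
    have hlast : x (Fin.last k) = y (Fin.last k) := by
      refine (hxy (Fin.last k)).elim id fun h => ?_
      rw [treeBranch_last, treeBranch_last, ← hinit] at h
      exact hN (Fin.last k) _ _ _ h.1 h.2
    rw [← Fin.snoc_init_self x, ← Fin.snoc_init_self y, hinit, hlast]

open Classical in
theorem card_filter_treeBranch_mem_le [Fintype β] {N : Fin k → Set α}
    (hN : ∀ (i : Fin k) u b b', child i u b ∈ N i → child i u b' ∈ N i → b = b')
    (B : Finset (Fin k)) :
    (Finset.univ.filter fun x => ∀ i ∉ B, treeBranch child k x i ∈ N i).card ≤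
      Fintype.card β ^ B.card := by
  rw [← Fintype.card_coe B, ← Fintype.card_fun, ← Finset.card_univ]
  refine Finset.card_le_card_of_injOn (fun x i => x i) (fun _ _ => Finset.mem_univ _)
    fun x hx y hy hxy => eq_of_forall_treeBranch_mem hN fun i => ?_
  simp only [Finset.coe_filter, Finset.mem_univ, true_and, Set.mem_ofPred_eq] at hx hy
  by_cases hi : i ∈ B
  · exact .inl (congrFun hxy ⟨i, hi⟩)
  · exact .inr ⟨hx i hi, hy i hi⟩

variable {E : Type*} [NormedAddCommGroup E] [InnerProductSpace ℂ E]

theorem orthonormal_snoc {u : Fin k → E} {w : E} (hu : Orthonormal ℂ u) (hw : ‖w‖ = 1)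
    (huw : ∀ i, inner ℂ (u i) w = 0) : Orthonormal ℂ (Fin.snoc u w : Fin (k + 1) → E) := by
  refine ⟨Fin.lastCases (by simpa using hw) fun i => by simpa using hu.1 i, ?_⟩
  refine Fin.lastCases (Fin.lastCases (fun h => absurd rfl h) fun j _ => ?_) fun i =>
    Fin.lastCases (fun _ => ?_) fun j hij => ?_
  · simpa using inner_eq_zero_symm.1 (huw j)
  · simpa using huw i
  · simpa using hu.2 fun h => hij (congrArg Fin.castSucc h)

variable [FiniteDimensional ℂ E] {L q : ℕ} {r s : ℝ}

theorem exists_separated_children (hr : 0 < r) (hr1 : r ≤ 1)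
    (hq : (q : ℝ) ≤ (1 / r) ^ (2 * L)) :
    ∃ child : ∀ k, (Fin k → E) → Fin q → E, ∀ k, k + L + 1 ≤ Module.finrank ℂ E →
      ∀ u b, ‖child k u b‖ = 1 ∧ (∀ i, inner ℂ (u i) (child k u b) = 0) ∧
        ∀ b', b ≠ b' → r ^ 2 / 8 < overlapDefect (child k u b) (child k u b') := by
  have hexists (k : ℕ) (u : Fin k → E) (hk : k + L + 1 ≤ Module.finrank ℂ E) :
      ∃ c : Fin q → E, ∀ b, ‖c b‖ = 1 ∧ (∀ i, inner ℂ (u i) (c b) = 0) ∧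
        ∀ b', b ≠ b' → r ^ 2 / 8 < overlapDefect (c b) (c b') := by
    obtain ⟨t, ht, hsep, hcard⟩ := exists_finset_of_le_packingNumber
      (le_packingNumber_sphere_orthogonal u (by simpa using hk) hr hr1 hq)
    let c := (t.equivFinOfCardEq hcard).symm
    exact ⟨fun b => c b, fun b => ⟨(ht (c b).2).1, (ht (c b).2).2, fun b' hbb' =>
      hsep (c b).2 (c b').2 fun h => hbb' (c.injective (Subtype.ext h))⟩⟩
  choose! child hchild using hexists
  exact ⟨child, fun k hk u => hchild k u hk⟩

open Classical in
theorem exists_orthonormal_tree (hr : 0 < r) (hr1 : r ≤ 1) (hrs : 4 * s ≤ r ^ 2 / 8)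
    (hq : (q : ℝ) ≤ (1 / r) ^ (2 * L)) (hk : k + L ≤ Module.finrank ℂ E) :
    ∃ T : (Fin k → Fin q) → Fin k → E, (∀ x, Orthonormal ℂ (T x)) ∧
      ∀ (v : Fin k → E) (B : Finset (Fin k)), (∀ i, ‖v i‖ = 1) →
        (Finset.univ.filter fun x => ∀ i ∉ B, overlapDefect (T x i) (v i) ≤ s).card ≤
          q ^ B.card := by
  obtain ⟨child, hchild⟩ := exists_separated_children (E := E) hr hr1 hq
  refine ⟨treeBranch child k, fun x => ?_, fun v B hv => ?_⟩
  · induction k with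
    | zero => exact ⟨fun i => i.elim0, fun i => i.elim0⟩
    | succ k ih =>
      obtain ⟨hnorm, horth, -⟩ :=
        hchild k (by omega) (treeBranch child k (Fin.init x)) (x (Fin.last k))
      exact orthonormal_snoc (ih (by omega) _) hnorm horth
  · have hunique (i : Fin k) (u : Fin i → E) (b b' : Fin q)
        (hb : overlapDefect (child i u b) (v i) ≤ s)
        (hb' : overlapDefect (child i u b') (v i) ≤ s) : b = b' := by
      by_contra hne
      obtain ⟨hnorm, -, hsep⟩ := hchild i (by omega) u b
      have htri := overlapDefect_le_two_mul_add hnorm (hv i) (hchild i (by omega) u b').1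
      rw [overlapDefect_comm (v i)] at htri
      linarith [hsep b' hne]
    simpa using card_filter_treeBranch_mem_le (N := fun i => {w | overlapDefect w (v i) ≤ s})
      hunique B

end Tree

/-! ### Separated unitaries -/

section Unitary

variable {ι : Type*} [Fintype ι] [DecidableEq ι]

/-- The columns of a unitary matrix as vectors of a Euclidean space. -/
def column (U : unitaryGroup ι ℂ) (a : ι) : EuclideanSpace ℂ ι :=
  WithLp.toLp 2 ((U : Matrix ι ι ℂ).col a)

theorem inner_column (U V : unitaryGroup ι ℂ) (a b : ι) :
    inner ℂ (column U a) (column V b) = ((U : Matrix ι ι ℂ)ᴴ * (V : Matrix ι ι ℂ)) a b := by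
  simp [column, PiLp.inner_apply, Matrix.mul_apply, mul_comm]

theorem conjTranspose_mul_self_unitary (U : unitaryGroup ι ℂ) :
    (U : Matrix ι ι ℂ)ᴴ * (U : Matrix ι ι ℂ) = 1 :=
  mem_unitaryGroup_iff'.1 U.2

theorem norm_column (U : unitaryGroup ι ℂ) (a : ι) : ‖column U a‖ = 1 := by
  rw [@norm_eq_sqrt_re_inner ℂ, inner_column, conjTranspose_mul_self_unitary,
    Matrix.one_apply_eq, RCLike.one_re, Real.sqrt_one]

theorem exists_unitary_of_orthonormal {κ : Type*} (j : κ ↪ ι) {u : κ → EuclideanSpace ℂ ι}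
    (hu : Orthonormal ℂ u) : ∃ U : unitaryGroup ι ℂ, ∀ i, column U (j i) = u i := by
  classical
  obtain ⟨v, hv⟩ : ∃ v : ι → EuclideanSpace ℂ ι, ∀ i, v (j i) = u i :=
    ⟨Function.extend j u 0, fun i => j.injective.extend_apply _ _ _⟩
  have hrange : Orthonormal ℂ ((Set.range j).domRestrict v) := by
    rw [orthonormal_iff_ite] at hu ⊢
    rintro ⟨_, a, rfl⟩ ⟨_, b, rfl⟩
    simpa [Set.domRestrict, hv, Subtype.ext_iff, j.injective.eq_iff] using hu a b
  obtain ⟨b, hb⟩ := hrange.exists_orthonormalBasis_extension_of_card_eq (by simp)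
  refine ⟨⟨_, (EuclideanSpace.basisFun ι ℂ).toMatrix_orthonormalBasis_mem_unitary b⟩, fun i => ?_⟩
  rw [← hv i, ← hb _ ⟨i, rfl⟩]
  ext a
  simp [column, Module.Basis.toMatrix_apply]

/-- The infidelity `1 - |tr (U† V)|² / d²` of two unitaries of dimension `d`, which measures how
far apart they are up to a phase. -/
def infidelity (U V : unitaryGroup ι ℂ) : ℝ :=
  1 - ‖((U : Matrix ι ι ℂ)ᴴ * (V : Matrix ι ι ℂ)).trace‖ ^ 2 / (Fintype.card ι : ℝ) ^ 2

theorem infidelity_comm (U V : unitaryGroup ι ℂ) : infidelity U V = infidelity V U := by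
  rw [infidelity, infidelity, ← norm_star (Matrix.trace _), ← Matrix.trace_conjTranspose,
    conjTranspose_mul, conjTranspose_conjTranspose]

theorem infidelity_self [Nonempty ι] (U : unitaryGroup ι ℂ) : infidelity U U = 0 := by
  simp [infidelity, conjTranspose_mul_self_unitary]

theorem sum_overlapDefect_column_le [Nonempty ι] (U V : unitaryGroup ι ℂ) :
    ∑ a, overlapDefect (column U a) (column V a) ≤ Fintype.card ι * infidelity U V := by
  set d : ℝ := (Fintype.card ι : ℝ) with hd
  set τ := ‖((U : Matrix ι ι ℂ)ᴴ * (V : Matrix ι ι ℂ)).trace‖ with hτ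
  have hd0 : 0 < d := by simp [hd, Fintype.card_pos]
  have htrace : τ ≤ ∑ a, ‖(inner ℂ (column U a) (column V a) : ℂ)‖ := by
    simp only [inner_column]
    exact norm_sum_le _ _
  have hoverlap : ∑ a, overlapDefect (column U a) (column V a) =
      d - ∑ a, ‖(inner ℂ (column U a) (column V a) : ℂ)‖ := by
    simp [overlapDefect, hd]
  have hτd : τ ≤ d := by
    have := Finset.sum_nonneg fun a (_ : a ∈ Finset.univ) =>
      overlapDefect_nonneg (norm_column U a) (norm_column V a)
    linarith
  have hdiv : τ ^ 2 / d ≤ τ := by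
    rw [div_le_iff₀ hd0, sq]
    exact mul_le_mul_of_nonneg_left hτd (norm_nonneg _)
  calc ∑ a, overlapDefect (column U a) (column V a) ≤ d - τ ^ 2 / d := by linarith
    _ = d * infidelity U V := by rw [infidelity, ← hτ, ← hd]; field_simp

theorem card_lt_overlapDefect_column_mul_le [Nonempty ι] {κ : Type*} [Fintype κ] (j : κ ↪ ι)
    (U V : unitaryGroup ι ℂ) (s : ℝ) :
    (Finset.univ.filter fun i => s < overlapDefect (column U (j i)) (column V (j i))).card * s ≤
      Fintype.card ι * infidelity U V := by
  set B := Finset.univ.filter fun i => s < overlapDefect (column U (j i)) (column V (j i))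
  calc (B.card : ℝ) * s ≤ ∑ i ∈ B, overlapDefect (column U (j i)) (column V (j i)) := by
        rw [← nsmul_eq_mul]
        exact Finset.card_nsmul_le_sum _ _ _ fun i hi => (Finset.mem_filter.1 hi).2.le
    _ = ∑ a ∈ B.map j, overlapDefect (column U a) (column V a) := by rw [Finset.sum_map]
    _ ≤ ∑ a, overlapDefect (column U a) (column V a) :=
        Finset.sum_le_sum_of_subset_of_nonneg (Finset.subset_univ _) fun a _ _ =>
          overlapDefect_nonneg (norm_column U a) (norm_column V a)
    _ ≤ _ := sum_overlapDefect_column_le U V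

variable {L q : ℕ} {r : ℝ}

open Classical in
theorem card_filter_infidelity_le (hcard : Fintype.card ι = 2 * L) (hL : 1 ≤ L) (hr : 0 < r)
    (hq : 1 ≤ q) (j : Fin L ↪ ι) {W : (Fin L → Fin q) → unitaryGroup ι ℂ}
    (hW : ∀ (v : Fin L → EuclideanSpace ℂ ι) (B : Finset (Fin L)), (∀ i, ‖v i‖ = 1) →
      (Finset.univ.filter fun x => ∀ i ∉ B,
        overlapDefect (column (W x) (j i)) (v i) ≤ r ^ 2 / 32).card ≤ q ^ B.card)
    (V : unitaryGroup ι ℂ) :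
    (Finset.univ.filter fun x => infidelity (W x) V ≤ r ^ 2 / 256).card ≤
      2 ^ L * q ^ (L / 4) := by
  have : Nonempty ι := Fintype.card_pos_iff.1 (by omega)
  let F : Finset (Fin L) → Finset (Fin L → Fin q) := fun B => Finset.univ.filter fun x =>
    ∀ i ∉ B, overlapDefect (column (W x) (j i)) (column V (j i)) ≤ r ^ 2 / 32
  have hcover : (Finset.univ.filter fun x => infidelity (W x) V ≤ r ^ 2 / 256) ⊆
      (Finset.univ.filter fun B : Finset (Fin L) => 4 * B.card ≤ L).biUnion F := by
    intro x hx
    -- Markov's inequality: at most a quarter of the `L` columns can be far apart.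
    have hmarkov := card_lt_overlapDefect_column_mul_le j (W x) V (r ^ 2 / 32)
    set B := Finset.univ.filter fun i =>
      r ^ 2 / 32 < overlapDefect (column (W x) (j i)) (column V (j i)) with hB
    have hbound : (B.card : ℝ) * (r ^ 2 / 32) ≤ 2 * L * (r ^ 2 / 256) := by
      rw [hcard, Nat.cast_mul, Nat.cast_ofNat] at hmarkov
      exact hmarkov.trans
        (mul_le_mul_of_nonneg_left (Finset.mem_filter.1 hx).2 (by positivity))
    have hBL : (4 * B.card : ℝ) ≤ L := by
      refine le_of_mul_le_mul_right ?_ (by positivity : 0 < r ^ 2)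
      linarith
    refine Finset.mem_biUnion.2 ⟨B, ?_, ?_⟩
    · exact Finset.mem_filter.2 ⟨Finset.mem_univ B, by exact_mod_cast hBL⟩
    · simp [F, hB]
  calc (Finset.univ.filter fun x => infidelity (W x) V ≤ r ^ 2 / 256).card
      ≤ (Finset.univ.filter fun B : Finset (Fin L) => 4 * B.card ≤ L).card * q ^ (L / 4) :=
        (Finset.card_le_card hcover).trans (Finset.card_biUnion_le_card_mul _ _ _ fun B hB =>
          (hW _ B fun i => norm_column V (j i)).trans
            (Nat.pow_le_pow_right hq (by have := (Finset.mem_filter.1 hB).2; omega)))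
    _ ≤ 2 ^ L * q ^ (L / 4) :=
        Nat.mul_le_mul_right _ ((Finset.card_filter_le _ _).trans (by simp))

theorem pow_le_packingNumber_infidelity_mul (hcard : Fintype.card ι = 2 * L) (hL : 1 ≤ L)
    (hr : 0 < r) (hr1 : r ≤ 1) (hq : 1 ≤ q) (hqr : (q : ℝ) ≤ (1 / r) ^ (2 * L)) :
    (q ^ L : ℕ∞) ≤ packingNumber (Set.univ : Set (unitaryGroup ι ℂ)) infidelity (r ^ 2 / 256) *
      (2 ^ L * q ^ (L / 4) : ℕ) := by
  classical
  have : Nonempty ι := Fintype.card_pos_iff.1 (by omega)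
  obtain ⟨j⟩ : Nonempty (Fin L ↪ ι) := Function.Embedding.nonempty_of_card_le (by simp; omega)
  obtain ⟨T, hTorth, hTcard⟩ := exists_orthonormal_tree (E := EuclideanSpace ℂ ι) (k := L)
    (s := r ^ 2 / 32) hr hr1 (by linarith) hqr (by rw [finrank_euclideanSpace, hcard]; omega)
  choose W hW using fun x => exists_unitary_of_orthonormal j (hTorth x)
  have hself : ∀ U : unitaryGroup ι ℂ, infidelity U U ≤ r ^ 2 / 256 := fun U => by
    rw [infidelity_self]; positivity
  have hfilter (y : Fin L → Fin q) := card_filter_infidelity_le hcard hL hr hq j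
    (W := W) (by simpa only [hW] using hTcard) (W y)
  have hpack := card_le_packingNumber_mul (T := Finset.univ)
    (d := fun x y => infidelity (W x) (W y)) (fun x => hself (W x))
    (fun x y => infidelity_comm _ _) fun y _ => hfilter y
  calc (q ^ L : ℕ∞) = ((Finset.univ : Finset (Fin L → Fin q)).card : ℕ∞) := by simp
    _ ≤ _ := hpack
    _ ≤ _ := mul_le_mul_left (packingNumber_le_of_mapsTo (φ := W) (fun _ _ => Set.mem_univ _)
        (fun U _ => hself U) fun _ _ _ _ h => h) _

theorem sq_mul_log_le_log_of_pow_le {m : ℕ} (hL : 1 ≤ L) (hr : 0 < r) (hr1 : r ≤ 1 / 16)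
    (h : ∀ q : ℕ, 1 ≤ q → (q : ℝ) ≤ (1 / r) ^ (2 * L) → q ^ L ≤ m * (2 ^ L * q ^ (L / 4))) :
    (L : ℝ) ^ 2 * Real.log (1 / r) ≤ Real.log m := by
  set y : ℝ := (1 / r) ^ (2 * L) with hy
  have hr16 : 16 ≤ 1 / r := by rwa [le_div_iff₀ hr, ← le_div_iff₀' (by norm_num)]
  have hy16 : 16 ≤ y := hr16.trans (le_self_pow₀ (by linarith) (by omega))
  have hyq : y / 2 ≤ ⌊y⌋₊ := by linarith [Nat.lt_floor_add_one y]
  have hq1 : 1 ≤ ⌊y⌋₊ := Nat.le_floor (by norm_num; linarith)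
  have hpow := h ⌊y⌋₊ hq1 (Nat.floor_le (by linarith))
  set q := ⌊y⌋₊
  have hm : m ≠ 0 := by
    rintro rfl
    exact absurd hpow (by rw [zero_mul, not_le]; positivity)
  have hlogm : L * Real.log q ≤ Real.log m + (L * Real.log 2 + (L / 4 : ℕ) * Real.log q) := by
    rw [← Real.log_pow, ← Real.log_pow, ← Real.log_pow, ← Real.log_mul (by positivity)
      (by positivity), ← Real.log_mul (by positivity) (by positivity)]
    exact Real.log_le_log (by positivity) (by exact_mod_cast hpow)
  have hlogq : 2 * L * Real.log (1 / r) - Real.log 2 ≤ Real.log q := by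
    have := Real.log_le_log (by positivity) hyq
    rw [Real.log_div (by positivity) two_ne_zero, hy, Real.log_pow] at this
    push_cast at this
    exact this
  have hlog2 : 4 * Real.log 2 ≤ Real.log (1 / r) := by
    calc 4 * Real.log 2 = Real.log (2 ^ 4) := by rw [Real.log_pow]; norm_num
      _ ≤ Real.log (1 / r) := Real.log_le_log (by norm_num) (by linarith)
  have hquarter : ((L / 4 : ℕ) : ℝ) * Real.log q ≤ L / 4 * Real.log q :=
    mul_le_mul_of_nonneg_right Nat.cast_div_le (Real.log_natCast_nonneg q)
  have hLr : (1 : ℝ) ≤ L := by exact_mod_cast hL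
  have hinner : (L : ℝ) * Real.log (1 / r) ≤ 3 / 4 * Real.log q - Real.log 2 := by
    nlinarith [Real.log_pos one_lt_two]
  calc (L : ℝ) ^ 2 * Real.log (1 / r) = L * (L * Real.log (1 / r)) := by ring
    _ ≤ L * (3 / 4 * Real.log q - Real.log 2) := mul_le_mul_of_nonneg_left hinner (by positivity)
    _ ≤ Real.log m := by linarith

theorem sq_mul_log_le_log_of_packingNumber_infidelity_le {m : ℕ}
    (hcard : Fintype.card ι = 2 * L) (hL : 1 ≤ L) (hr : 0 < r) (hr1 : r ≤ 1 / 16)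
    (hm : packingNumber (Set.univ : Set (unitaryGroup ι ℂ)) infidelity (r ^ 2 / 256) ≤ m) :
    (L : ℝ) ^ 2 * Real.log (1 / r) ≤ Real.log m :=
  sq_mul_log_le_log_of_pow_le hL hr hr1 fun q hq hqr => by
    have hpack := (pow_le_packingNumber_infidelity_mul hcard hL hr (by linarith) hq hqr).trans
      (mul_le_mul_left hm _)
    exact_mod_cast hpack

end Unitary

/-! ### Pure states -/

section Pure

variable {ι : Type*} [Fintype ι] {u v : EuclideanSpace ℂ ι}

/-- The pure state `|ψ⟩⟨ψ|` of a unit vector. -/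
def pureState (ψ : EuclideanSpace ℂ ι) (hψ : ‖ψ‖ = 1) : DensityMatrix ι :=
  ⟨vecMulVec ψ.ofLp (star ψ.ofLp), posSemidef_vecMulVec_self_star _, by
    rw [trace_vecMulVec, ← EuclideanSpace.inner_eq_star_dotProduct, inner_self_eq_norm_sq_to_K, hψ]
    norm_num⟩

theorem trace_pureState_mul_pureState (hu : ‖u‖ = 1) (hv : ‖v‖ = 1) :
    ((pureState u hu).1 * (pureState v hv).1).trace = (‖inner ℂ u v‖ ^ 2 : ℝ) := by
  simp only [pureState, vecMulVec_mul_vecMulVec, trace_vecMulVec, dotProduct_smul, smul_eq_mul]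
  rw [dotProduct_comm (star u.ofLp), ← EuclideanSpace.inner_eq_star_dotProduct,
    ← EuclideanSpace.inner_eq_star_dotProduct, ← inner_conj_symm v u, RCLike.mul_conj]
  norm_cast

theorem rank_add_le (A B : Matrix ι ι ℂ) : (A + B).rank ≤ A.rank + B.rank := by
  rw [Matrix.rank, Matrix.rank, Matrix.rank, Matrix.mulVecLin_add]
  exact (Submodule.finrank_mono (LinearMap.range_add_le _ _)).trans
    (Submodule.finrank_add_le_finrank_add_finrank _ _)

theorem rank_pureState_sub_le_two (hu : ‖u‖ = 1) (hv : ‖v‖ = 1) :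
    ((pureState u hu).1 - (pureState v hv).1).rank ≤ 2 := by
  simp only [pureState, sub_eq_add_neg, ← neg_vecMulVec]
  exact (rank_add_le _ _).trans (add_le_add (rank_vecMulVec_le _ _) (rank_vecMulVec_le _ _))

variable [DecidableEq ι]

open scoped Matrix.Norms.Frobenius in
theorem traceDist_sq_eq_of_rank_sub_le_two {ρ σ : DensityMatrix ι} (h : (ρ.1 - σ.1).rank ≤ 2) :
    traceDist ρ σ ^ 2 = 1 / 2 * ‖ρ.1 - σ.1‖ ^ 2 := by
  set A := ρ.toSelfAdjoint - σ.toSelfAdjoint with hA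
  have hcoe : A.1 = ρ.1 - σ.1 := rfl
  have htraceless : A.1.trace = 0 := by rw [hcoe, trace_sub, ρ.2.2, σ.2.2, sub_self]
  have hge := two_mul_frobenius_norm_sq_le_traceNorm_sq htraceless
  have hle := traceNorm_sq_le_rank_mul A
  have hrank : (A.1.rank : ℝ) * ‖A.1‖ ^ 2 ≤ 2 * ‖A.1‖ ^ 2 :=
    mul_le_mul_of_nonneg_right (by rw [hcoe]; exact_mod_cast h) (sq_nonneg _)
  rw [traceDist_eq_traceNorm_sub, ← hA, ← hcoe, mul_pow]
  linarith

open scoped Matrix.Norms.Frobenius in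
theorem traceDist_pureState_sq (hu : ‖u‖ = 1) (hv : ‖v‖ = 1) :
    traceDist (pureState u hu) (pureState v hv) ^ 2 = 1 - ‖inner ℂ u v‖ ^ 2 := by
  rw [traceDist_sq_eq_of_rank_sub_le_two (rank_pureState_sub_le_two hu hv)]
  have hnorm := trace_conjTranspose_mul_self ((pureState u hu).1 - (pureState v hv).1)
  rw [conjTranspose_sub, (pureState u hu).2.1.isHermitian.eq, (pureState v hv).2.1.isHermitian.eq,
    Matrix.sub_mul, Matrix.mul_sub, Matrix.mul_sub, trace_sub, trace_sub, trace_sub,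
    trace_pureState_mul_pureState, trace_pureState_mul_pureState, trace_pureState_mul_pureState,
    trace_pureState_mul_pureState, norm_inner_symm v u, inner_self_eq_norm_sq_to_K,
    inner_self_eq_norm_sq_to_K, hu, hv] at hnorm
  have hreal : ‖(pureState u hu).1 - (pureState v hv).1‖ ^ 2 = 2 - 2 * ‖inner ℂ u v‖ ^ 2 := by
    apply Complex.ofReal_injective
    rw [← hnorm]
    push_cast
    norm_num
    ring
  rw [hreal]
  ring

theorem traceDist_pureState_le_dist (hu : ‖u‖ = 1) (hv : ‖v‖ = 1) :
    traceDist (pureState u hu) (pureState v hv) ≤ dist u v := by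
  refine (sq_le_sq₀ (traceDist_nonneg _ _) dist_nonneg).1 ?_
  have h := two_mul_overlapDefect_le_norm_sub_sq hu hv
  rw [overlapDefect] at h
  rw [traceDist_pureState_sq, dist_eq_norm]
  linarith [sq_nonneg (1 - ‖(inner ℂ u v : ℂ)‖)]

theorem coveringNumber_pureState_le {K : Set (DensityMatrix ι)} {η : ℝ} (hη : 0 < η)
    (hK : ∀ ρ ∈ K, ∃ ψ, ∃ hψ : ‖ψ‖ = 1, pureState ψ hψ = ρ) :
    coveringNumber K traceDist η ≤ ⌊(1 + 2 / η) ^ (2 * Fintype.card ι)⌋₊ := by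
  choose! ψ hψ hψK using hK
  have hdist : ∀ ρ ∈ K, ∀ σ ∈ K, η < traceDist ρ σ → η < dist (ψ ρ) (ψ σ) :=
    fun ρ hρ σ hσ h => h.trans_le <| by
      conv_lhs => rw [← hψK ρ hρ, ← hψK σ hσ]
      exact traceDist_pureState_le_dist _ _
  calc coveringNumber K traceDist η ≤ packingNumber K traceDist η :=
        coveringNumber_le_packingNumber (fun ρ => (traceDist_self ρ).trans_le hη.le) traceDist_comm
    _ ≤ packingNumber (Metric.closedBall (0 : EuclideanSpace ℂ ι) 1) dist η :=
        packingNumber_le_of_mapsTo (fun ρ hρ => mem_closedBall_zero_iff.2 (hψ ρ hρ).le)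
          (fun x _ => (dist_self x).trans_le hη.le) hdist
    _ ≤ _ := packingNumber_closedBall_le hη
    _ = _ := by rw [finrank_real_of_complex, finrank_euclideanSpace]

theorem conjState_conjState (U V : unitaryGroup ι ℂ) (ρ : DensityMatrix ι) :
    conjState U (conjState V ρ) = conjState (U * V) ρ := by
  apply Subtype.ext
  simp [conjState, Matrix.mul_assoc, conjTranspose_mul]

theorem conjState_zeroState {n : ℕ} (U : QubitUnitary n) :
    conjState U (zeroState n) = pureState (column U 0) (norm_column U 0) := by
  refine Subtype.ext (Matrix.ext fun a b => ?_)
  simp only [conjState, zeroState, mul_apply, diagonal_apply]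
  simp [pureState, column, vecMulVec_apply, Pi.single_apply]

end Pure

/-! ### Topology of the unitary group -/

section UnitaryTopology

variable {ι : Type*} [Fintype ι] [DecidableEq ι]

theorem isCompact_unitaryGroup : IsCompact (unitaryGroup ι ℂ : Set (Matrix ι ι ℂ)) := by
  have hclosed : IsClosed (unitaryGroup ι ℂ : Set (Matrix ι ι ℂ)) := by
    have : (unitaryGroup ι ℂ : Set (Matrix ι ι ℂ)) = {A | A * star A = 1} := by
      ext A
      exact mem_unitaryGroup_iff
    rw [this]
    exact isClosed_eq (continuous_id.matrix_mul continuous_id.star) continuous_const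
  have hcompact : IsCompact (Set.univ.pi fun _ : ι => Set.univ.pi fun _ : ι =>
      Metric.closedBall (0 : ℂ) 1) :=
    isCompact_univ_pi fun _ => isCompact_univ_pi fun _ => isCompact_closedBall _ _
  exact hcompact.of_isClosed_subset hclosed fun A hA i _ j _ =>
    mem_closedBall_zero_iff.2 (entry_norm_bound_of_unitary hA i j)

instance compactSpace_unitaryGroup : CompactSpace (unitaryGroup ι ℂ) :=
  isCompact_iff_compactSpace.1 isCompact_unitaryGroup

theorem continuous_conjState_left (ρ : DensityMatrix ι) :
    Continuous fun U : unitaryGroup ι ℂ => conjState U ρ :=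
  Continuous.subtype_mk ((continuous_subtype_val.matrix_mul continuous_const).matrix_mul
    continuous_subtype_val.matrix_conjTranspose) _

theorem continuous_conjState (U : unitaryGroup ι ℂ) : Continuous (conjState U) :=
  Continuous.subtype_mk ((continuous_const.matrix_mul continuous_subtype_val).matrix_mul
    continuous_const) _

theorem support_map_conjState_subset_range (ν : Measure (unitaryGroup ι ℂ))
    (ρ : DensityMatrix ι) :
    (ν.map fun U => conjState U ρ).support ⊆ Set.range fun U => conjState U ρ := by
  have hcont := continuous_conjState_left ρ
  have hclosed := (isCompact_range hcont).isClosed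
  refine Measure.support_subset_of_isClosed hclosed ?_
  rw [mem_ae_map_iff hcont.measurable.aemeasurable hclosed.measurableSet]
  exact Filter.univ_mem' fun U => ⟨U, rfl⟩

end UnitaryTopology

/-! ### Averages over products of single-qubit stabilizer states -/

section StabilizerState

theorem conj_inv_sqrt_two_mul_self : star ((√2 : ℝ) : ℂ)⁻¹ * ((√2 : ℝ) : ℂ)⁻¹ = 1 / 2 := by
  rw [star_inv₀, Complex.star_def, Complex.conj_ofReal, ← mul_inv, ← Complex.ofReal_mul,
    Real.mul_self_sqrt zero_le_two]
  norm_num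

/-- The amplitudes of the equatorial qubit state `(|0⟩ + w |1⟩) / √2` with phase `w`. -/
def phaseState (w : ℂ) : Fin 2 → ℂ := ![((√2 : ℝ) : ℂ)⁻¹, ((√2 : ℝ) : ℂ)⁻¹ * w]

/-- The amplitudes of the six single-qubit stabilizer states, the eigenvectors of the Pauli
matrices. -/
def stabState : Fin 6 → Fin 2 → ℂ :=
  ![![1, 0], ![0, 1], phaseState 1, phaseState (-1), phaseState Complex.I,
    phaseState (-Complex.I)]

theorem sum_star_phaseState_mul {w : ℂ} (hw : star w * w = 1) (Z : Fin 2 → Fin 2 → ℂ) :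
    ∑ a, ∑ b, star (phaseState w a) * Z a b * phaseState w b =
      1 / 2 * (Z 0 0 + Z 1 1 + (w * Z 0 1 + star w * Z 1 0)) := by
  simp only [Fin.sum_univ_two, phaseState, cons_val_zero, cons_val_one, star_mul]
  linear_combination (Z 0 0 + w * Z 0 1 + star w * Z 1 0 + star w * w * Z 1 1) *
    conj_inv_sqrt_two_mul_self + 1 / 2 * Z 1 1 * hw

theorem star_stabState_mul_self (s : Fin 6) :
    star (stabState s 0) * stabState s 0 + star (stabState s 1) * stabState s 1 = 1 := by
  have hphase {w : ℂ} (hw : star w * w = 1) :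
      star (phaseState w 0) * phaseState w 0 + star (phaseState w 1) * phaseState w 1 = 1 := by
    have h := sum_star_phaseState_mul hw (1 : Matrix (Fin 2) (Fin 2) ℂ)
    norm_num [Fin.sum_univ_two] at h
    exact h
  fin_cases s
  · simp [stabState]
  · simp [stabState]
  · exact hphase (by simp)
  · exact hphase (by simp)
  · exact hphase (by simp)
  · exact hphase (by simp)

/-- A single-qubit unitary that prepares a stabilizer state from `|0⟩`. -/
def stabUnitary (s : Fin 6) : unitaryGroup (Fin 2) ℂ :=
  ⟨!![stabState s 0, -star (stabState s 1); stabState s 1, star (stabState s 0)], by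
    have h := star_stabState_mul_self s
    rw [mem_unitaryGroup_iff']
    ext i j
    fin_cases i <;> fin_cases j <;>
      simp [Matrix.mul_apply, Fin.sum_univ_two, Matrix.star_apply] at h ⊢
    · linear_combination h
    · ring
    · ring
    · linear_combination h⟩

theorem stabUnitary_apply_zero (s : Fin 6) (a : Fin 2) :
    (stabUnitary s : Matrix (Fin 2) (Fin 2) ℂ) a 0 = stabState s a := by
  fin_cases a <;> rfl

/-- The stabilizer states form a 2-design. -/
theorem sum_norm_sq_sum_stabState (Z : Fin 2 → Fin 2 → ℂ) :
    ∑ s, ‖∑ a, ∑ b, star (stabState s a) * Z a b * stabState s b‖ ^ 2 =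
      ‖Z 0 0 + Z 1 1‖ ^ 2 + ∑ a, ∑ b, ‖Z a b‖ ^ 2 := by
  have hpair {w : ℂ} (hw : star w * w = 1) :
      ‖∑ a, ∑ b, star (phaseState w a) * Z a b * phaseState w b‖ ^ 2 +
        ‖∑ a, ∑ b, star (phaseState (-w) a) * Z a b * phaseState (-w) b‖ ^ 2 =
      1 / 2 * (‖Z 0 0 + Z 1 1‖ ^ 2 + ‖w * Z 0 1 + star w * Z 1 0‖ ^ 2) := by
    have h := parallelogram_law_with_norm ℂ (Z 0 0 + Z 1 1) (w * Z 0 1 + star w * Z 1 0)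
    rw [sum_star_phaseState_mul hw, sum_star_phaseState_mul (w := -w) (by simpa using hw),
      star_neg, neg_mul, neg_mul, ← neg_add, ← sub_eq_add_neg, norm_mul, norm_mul, mul_pow,
      mul_pow]
    have hhalf : ‖(1 / 2 : ℂ)‖ = 1 / 2 := by norm_num
    rw [hhalf]
    linarith
  have hoff := parallelogram_law_with_norm ℂ (Z 0 1) (Z 1 0)
  have hX := hpair (w := 1) (by simp)
  have hY := hpair (w := Complex.I) (by simp)
  have hI : ‖Complex.I * Z 0 1 + star Complex.I * Z 1 0‖ = ‖Z 0 1 - Z 1 0‖ := by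
    rw [Complex.star_def, Complex.conj_I, neg_mul, ← sub_eq_add_neg, ← mul_sub, norm_mul,
      Complex.norm_I, one_mul]
  have h0 : ∑ a, ∑ b, star (stabState 0 a) * Z a b * stabState 0 b = Z 0 0 := by
    simp [Fin.sum_univ_two, stabState]
  have h1 : ∑ a, ∑ b, star (stabState 1 a) * Z a b * stabState 1 b = Z 1 1 := by
    simp [Fin.sum_univ_two, stabState]
  rw [hI] at hY
  rw [star_one, one_mul, one_mul] at hX
  have hentries : ∑ a, ∑ b, ‖Z a b‖ ^ 2 =
      ‖Z 0 0‖ ^ 2 + ‖Z 0 1‖ ^ 2 + (‖Z 1 0‖ ^ 2 + ‖Z 1 1‖ ^ 2) := by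
    simp only [Fin.sum_univ_two]
  rw [Fin.sum_univ_six, h0, h1, hentries]
  change _ + _ + ‖∑ a, ∑ b, star (phaseState 1 a) * Z a b * phaseState 1 b‖ ^ 2 +
    ‖∑ a, ∑ b, star (phaseState (-1) a) * Z a b * phaseState (-1) b‖ ^ 2 +
    ‖∑ a, ∑ b, star (phaseState Complex.I a) * Z a b * phaseState Complex.I b‖ ^ 2 +
    ‖∑ a, ∑ b, star (phaseState (-Complex.I) a) * Z a b * phaseState (-Complex.I) b‖ ^ 2 = _
  linarith

end StabilizerState

section StabilizerAverage

variable {n : ℕ}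

/-- The expectation of `Y` in the product of the stabilizer states with labels `s`. -/
def stabExpect (Y : Matrix (Qubits n) (Qubits n) ℂ) (s : Fin n → Fin 6) : ℂ :=
  ∑ x, ∑ y, star (∏ i, stabState (s i) (x i)) * Y x y * ∏ i, stabState (s i) (y i)

theorem stabExpect_add (Y Z : Matrix (Qubits n) (Qubits n) ℂ) (s : Fin n → Fin 6) :
    stabExpect (Y + Z) s = stabExpect Y s + stabExpect Z s := by
  simp only [stabExpect, Matrix.add_apply, mul_add, add_mul, Finset.sum_add_distrib]

theorem conjTranspose_tensorUnitary_mul_mul_apply_zero (Y : Matrix (Qubits n) (Qubits n) ℂ)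
    (s : Fin n → Fin 6) :
    ((tensorUnitary fun i => stabUnitary (s i)).1ᴴ * Y *
      (tensorUnitary fun i => stabUnitary (s i)).1) 0 0 = stabExpect Y s := by
  rw [Matrix.mul_assoc, Matrix.mul_apply]
  refine Finset.sum_congr rfl fun x _ => ?_
  rw [Matrix.mul_apply, Finset.mul_sum]
  refine Finset.sum_congr rfl fun y _ => ?_
  simp only [tensorUnitary, Matrix.conjTranspose_apply, Matrix.of_apply, Pi.zero_apply,
    stabUnitary_apply_zero, mul_assoc]

/-- The blocks of a matrix with respect to the first qubit. -/
def qubitBlock (Y : Matrix (Qubits (n + 1)) (Qubits (n + 1)) ℂ) (a b : Fin 2) :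
    Matrix (Qubits n) (Qubits n) ℂ :=
  Matrix.of fun x y => Y (Fin.cons a x) (Fin.cons b y)

theorem sum_fin_cons {α M : Type*} [Fintype α] [AddCommMonoid M] (F : (Fin (n + 1) → α) → M) :
    ∑ x, F x = ∑ a, ∑ x : Fin n → α, F (Fin.cons a x) := by
  rw [← Fintype.sum_prod_type']
  exact (Fintype.sum_equiv (Fin.consEquiv fun _ => α) _ _ fun _ => rfl).symm

theorem sum_sum_fin_cons {α M : Type*} [Fintype α] [AddCommMonoid M]
    (F : (Fin (n + 1) → α) → (Fin (n + 1) → α) → M) :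
    ∑ x, ∑ y, F x y = ∑ a, ∑ b, ∑ x : Fin n → α, ∑ y : Fin n → α,
      F (Fin.cons a x) (Fin.cons b y) := by
  simp only [sum_fin_cons]
  exact Finset.sum_congr rfl fun a _ => Finset.sum_comm

theorem stabExpect_cons (Y : Matrix (Qubits (n + 1)) (Qubits (n + 1)) ℂ) (s₀ : Fin 6)
    (s : Fin n → Fin 6) : stabExpect Y (Fin.cons s₀ s) =
      ∑ a, ∑ b, star (stabState s₀ a) * stabExpect (qubitBlock Y a b) s * stabState s₀ b := by
  simp only [stabExpect, sum_sum_fin_cons, Finset.mul_sum, Finset.sum_mul]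
  refine Finset.sum_congr rfl fun a _ => Finset.sum_congr rfl fun b _ =>
    Finset.sum_congr rfl fun x _ => Finset.sum_congr rfl fun y _ => ?_
  simp only [Fin.prod_univ_succ, Fin.cons_zero, Fin.cons_succ, qubitBlock, Matrix.of_apply,
    star_mul']
  ring

theorem sum_norm_stabExpect_sq_succ (Y : Matrix (Qubits (n + 1)) (Qubits (n + 1)) ℂ) :
    ∑ s, ‖stabExpect Y s‖ ^ 2 =
      ∑ s, ‖stabExpect (qubitBlock Y 0 0 + qubitBlock Y 1 1) s‖ ^ 2 +
        ∑ a, ∑ b, ∑ s, ‖stabExpect (qubitBlock Y a b) s‖ ^ 2 := by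
  have hfirst (s : Fin n → Fin 6) :=
    sum_norm_sq_sum_stabState fun a b => stabExpect (qubitBlock Y a b) s
  rw [sum_fin_cons, Finset.sum_comm]
  simp only [stabExpect_cons, hfirst, stabExpect_add]
  simp only [Finset.sum_add_distrib, Fin.sum_univ_two]

theorem trace_eq_trace_qubitBlock_add (Y : Matrix (Qubits (n + 1)) (Qubits (n + 1)) ℂ) :
    Y.trace = (qubitBlock Y 0 0 + qubitBlock Y 1 1).trace := by
  rw [trace_add, Matrix.trace, sum_fin_cons, Fin.sum_univ_two]
  rfl

open scoped Matrix.Norms.Frobenius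

theorem frobenius_norm_add_sq_add_norm_sub_sq {ι : Type*} [Fintype ι] (A B : Matrix ι ι ℂ) :
    ‖A + B‖ ^ 2 + ‖A - B‖ ^ 2 = 2 * (‖A‖ ^ 2 + ‖B‖ ^ 2) := by
  simp only [frobenius_norm_sq, ← Finset.sum_add_distrib, Finset.mul_sum]
  refine Finset.sum_congr rfl fun x _ => Finset.sum_congr rfl fun y _ => ?_
  exact parallelogram_law_with_norm ℂ (A x y) (B x y)

theorem norm_trace_sq_le_card_mul {ι : Type*} [Fintype ι] (A : Matrix ι ι ℂ) :
    ‖A.trace‖ ^ 2 ≤ Fintype.card ι * ‖A‖ ^ 2 := by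
  have hdiag : ∑ x, ‖A x x‖ ^ 2 ≤ ‖A‖ ^ 2 := by
    rw [frobenius_norm_sq]
    exact Finset.sum_le_sum fun x _ => Finset.single_le_sum (f := fun y => ‖A x y‖ ^ 2)
      (fun _ _ => sq_nonneg _) (Finset.mem_univ x)
  calc ‖A.trace‖ ^ 2 ≤ (∑ x, ‖A x x‖) ^ 2 := by gcongr; exact norm_sum_le _ _
    _ ≤ Fintype.card ι * ∑ x, ‖A x x‖ ^ 2 := sq_sum_le_card_mul_sum_sq
    _ ≤ _ := by gcongr

theorem frobenius_norm_sq_eq_sum_qubitBlock (Y : Matrix (Qubits (n + 1)) (Qubits (n + 1)) ℂ) :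
    ‖Y‖ ^ 2 = ∑ a, ∑ b, ‖qubitBlock Y a b‖ ^ 2 := by
  simp only [frobenius_norm_sq]
  rw [sum_sum_fin_cons]
  rfl

theorem three_mul_sum_norm_stabExpect_sq_le (Y : Matrix (Qubits n) (Qubits n) ℂ) :
    3 * ∑ s, ‖stabExpect Y s‖ ^ 2 ≤ 3 ^ n * ‖Y‖ ^ 2 + 2 * ((3 / 2) ^ n * ‖Y.trace‖ ^ 2) := by
  induction n with
  | zero =>
    simp only [frobenius_norm_sq, stabExpect, Matrix.trace, Fintype.sum_unique]
    simp
    linarith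
  | succ n ih =>
    have htrace (M : Matrix (Qubits n) (Qubits n) ℂ) :
        (3 / 2) ^ n * ‖M.trace‖ ^ 2 ≤ 3 ^ n * ‖M‖ ^ 2 := by
      calc (3 / 2 : ℝ) ^ n * ‖M.trace‖ ^ 2 ≤ (3 / 2) ^ n * (2 ^ n * ‖M‖ ^ 2) := by
            gcongr
            simpa using norm_trace_sq_le_card_mul M
        _ = 3 ^ n * ‖M‖ ^ 2 := by rw [← mul_assoc, ← mul_pow]; norm_num
    set A := qubitBlock Y 0 0
    set B := qubitBlock Y 1 1
    have hsub := htrace (A - B)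
    have hnorm := congrArg ((3 : ℝ) ^ n * ·) (frobenius_norm_add_sq_add_norm_sub_sq A B)
    have htr := congrArg ((3 / 2 : ℝ) ^ n * ·) (parallelogram_law_with_norm ℂ A.trace B.trace)
    rw [trace_sub] at hsub
    simp only [mul_add] at hnorm htr
    rw [sum_norm_stabExpect_sq_succ, frobenius_norm_sq_eq_sum_qubitBlock,
      trace_eq_trace_qubitBlock_add, pow_succ, pow_succ]
    simp only [Fin.sum_univ_two]
    have hAB := ih (A + B)
    rw [trace_add] at hAB ⊢
    linarith [ih A, ih B, ih (qubitBlock Y 0 1), ih (qubitBlock Y 1 0),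
      htrace (qubitBlock Y 0 1), htrace (qubitBlock Y 1 0)]

end StabilizerAverage

/-! ### Locally scrambled ensembles -/

section SecondMoment

variable {n : ℕ}

/-- The expectation `⟨0|W† X W|0⟩` of `X` in the state that `W` prepares from `|0⟩`. -/
def outputExpect (X : Matrix (Qubits n) (Qubits n) ℂ) (W : QubitUnitary n) : ℂ :=
  ((W : Matrix (Qubits n) (Qubits n) ℂ)ᴴ * X * W) 0 0

theorem continuous_outputExpect (X : Matrix (Qubits n) (Qubits n) ℂ) :
    Continuous (outputExpect X) :=
  ((continuous_subtype_val.matrix_conjTranspose.matrix_mul continuous_const).matrix_mul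
    continuous_subtype_val).matrix_elem 0 0

theorem integrable_of_continuous {α E : Type*} [TopologicalSpace α] [CompactSpace α]
    [MeasurableSpace α] [OpensMeasurableSpace α] [NormedAddCommGroup E]
    [SecondCountableTopology E] {ν : Measure α} [IsFiniteMeasure ν] {F : α → E}
    (hF : Continuous F) : Integrable F ν := by
  borelize E
  obtain ⟨C, hC⟩ := (isCompact_range hF.norm).bddAbove
  exact Integrable.of_bound hF.measurable.aestronglyMeasurable C
    (Filter.Eventually.of_forall fun a => hC ⟨a, rfl⟩)

theorem trace_mul_secondMoment (ν : Measure (QubitUnitary n)) [IsFiniteMeasure ν]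
    (A : Matrix (Qubits n × Qubits n) (Qubits n × Qubits n) ℂ)
    (ρ : DensityMatrix (Qubits n × Qubits n)) :
    (A * secondMoment ν ρ).trace =
      ∫ W, (A * ((W.1 ⊗ₖ W.1) * ρ.1 * (W.1 ⊗ₖ W.1)ᴴ)).trace ∂ν := by
  have hkronecker : Continuous fun W : QubitUnitary n => W.1 ⊗ₖ W.1 :=
    continuous_matrix fun p q => (continuous_subtype_val.matrix_elem p.1 q.1).mul
      (continuous_subtype_val.matrix_elem p.2 q.2)
  have hcont (p q) : Continuous fun W : QubitUnitary n =>
      A p q * ((W.1 ⊗ₖ W.1) * ρ.1 * (W.1 ⊗ₖ W.1)ᴴ) q p :=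
    continuous_const.mul (((hkronecker.matrix_mul continuous_const).matrix_mul
      hkronecker.matrix_conjTranspose).matrix_elem q p)
  simp only [Matrix.trace, Matrix.diag_apply, Matrix.mul_apply (M := A)]
  rw [integral_finsetSum _ fun p _ => integrable_finsetSum _ fun q _ =>
    integrable_of_continuous (hcont p q)]
  refine Finset.sum_congr rfl fun p _ => ?_
  rw [integral_finsetSum _ fun q _ => integrable_of_continuous (hcont p q)]
  exact Finset.sum_congr rfl fun q _ => (integral_const_mul _ _).symm

/-- The pure state `|0⟩⟨0|` on two copies of the `n`-qubit system. -/
def zeroPair (n : ℕ) : DensityMatrix (Qubits n × Qubits n) :=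
  ⟨Matrix.diagonal (Pi.single 0 1),
    Matrix.PosSemidef.diagonal (Pi.single_nonneg.2 zero_le_one),
    by simp [Matrix.trace_diagonal]⟩

theorem trace_mul_zeroPair (A : Matrix (Qubits n × Qubits n) (Qubits n × Qubits n) ℂ) :
    (A * (zeroPair n).1).trace = A 0 0 := by
  simp [zeroPair, Matrix.trace, Matrix.mul_diagonal, Pi.single_apply]

theorem norm_outputExpect_sq_eq_trace (X : Matrix (Qubits n) (Qubits n) ℂ) (W : QubitUnitary n) :
    ((‖outputExpect X W‖ ^ 2 : ℝ) : ℂ) =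
      ((X ⊗ₖ Xᴴ) * ((W.1 ⊗ₖ W.1) * (zeroPair n).1 * (W.1 ⊗ₖ W.1)ᴴ)).trace := by
  have hadjoint : W.1ᴴ * Xᴴ * W.1 = (W.1ᴴ * X * W.1)ᴴ := by
    simp only [conjTranspose_mul, conjTranspose_conjTranspose, Matrix.mul_assoc]
  have hkronecker : (W.1 ⊗ₖ W.1)ᴴ * ((X ⊗ₖ Xᴴ) * (W.1 ⊗ₖ W.1)) =
      (W.1ᴴ * X * W.1) ⊗ₖ (W.1ᴴ * X * W.1)ᴴ := by
    rw [← hadjoint, conjTranspose_kronecker, ← mul_kronecker_mul, ← mul_kronecker_mul,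
      Matrix.mul_assoc, Matrix.mul_assoc]
  rw [← Matrix.mul_assoc, Matrix.trace_mul_comm, ← Matrix.mul_assoc (X ⊗ₖ Xᴴ), ← Matrix.mul_assoc,
    hkronecker, trace_mul_zeroPair, Complex.ofReal_pow, ← Complex.mul_conj']
  rfl

theorem integral_norm_outputExpect_sq (ν : Measure (QubitUnitary n)) [IsFiniteMeasure ν]
    (X : Matrix (Qubits n) (Qubits n) ℂ) :
    ((∫ W, ‖outputExpect X W‖ ^ 2 ∂ν : ℝ) : ℂ) =
      ((X ⊗ₖ Xᴴ) * secondMoment ν (zeroPair n)).trace := by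
  rw [← integral_complex_ofReal, trace_mul_secondMoment]
  simp only [norm_outputExpect_sq_eq_trace]

end SecondMoment

section LocallyScrambled

variable {n : ℕ}

theorem card_mul_integral_le_of_measurePreserving {α κ : Type*} [MeasurableSpace α] [Fintype κ]
    {ν : Measure α} [IsProbabilityMeasure ν] {T : κ → α → α} {h : α → ℝ} {C : ℝ}
    (hT : ∀ s, MeasurePreserving (T s) ν ν) (hh : Integrable h ν)
    (hC : ∀ a, ∑ s, h (T s a) ≤ C) : Fintype.card κ * ∫ a, h a ∂ν ≤ C := by
  have hint (s : κ) : Integrable (fun a => h (T s a)) ν := (hT s).integrable_comp_of_integrable hh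
  have hinv (s : κ) : ∫ a, h (T s a) ∂ν = ∫ a, h a ∂ν := by
    rw [← integral_map (hT s).aemeasurable (by rw [(hT s).map_eq]; exact hh.1), (hT s).map_eq]
  calc Fintype.card κ * ∫ a, h a ∂ν = ∫ a, ∑ s, h (T s a) ∂ν := by
        rw [integral_finsetSum _ fun s _ => hint s, Finset.sum_congr rfl fun s _ => hinv s]
        simp
    _ ≤ ∫ _, C ∂ν := integral_mono (integrable_finsetSum _ fun s _ => hint s)
        (integrable_const C) hC
    _ = C := by simp

open scoped Matrix.Norms.Frobenius in
theorem three_mul_sum_norm_outputExpect_sq_le (X W : QubitUnitary n) :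
    3 * ∑ s : Fin n → Fin 6, ‖outputExpect X.1 (W * tensorUnitary fun i => stabUnitary (s i))‖ ^ 2 ≤
      6 ^ n * (1 + 2 * (‖X.1.trace‖ ^ 2 / 4 ^ n)) := by
  have hexpect (s : Fin n → Fin 6) :
      outputExpect X.1 (W * tensorUnitary fun i => stabUnitary (s i)) =
        stabExpect (W.1ᴴ * X.1 * W.1) s := by
    rw [← conjTranspose_tensorUnitary_mul_mul_apply_zero]
    simp only [outputExpect, Submonoid.coe_mul, conjTranspose_mul, Matrix.mul_assoc]
  have htrace : (W.1ᴴ * X.1 * W.1).trace = X.1.trace := by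
    have hW : W.1 * W.1ᴴ = 1 := mem_unitaryGroup_iff.1 W.2
    rw [Matrix.trace_mul_comm, ← Matrix.mul_assoc, hW, Matrix.one_mul]
  have hnorm : ‖W.1ᴴ * X.1 * W.1‖ ^ 2 = 2 ^ n := by
    have h := trace_conjTranspose_mul_self (W⁻¹ * X * W).1
    rw [conjTranspose_mul_self_unitary, Matrix.trace_one] at h
    have hcard : (Fintype.card (Qubits n) : ℂ) = (2 ^ n : ℝ) := by simp
    exact (Complex.ofReal_injective (hcard.symm.trans h)).symm
  have hpow : (6 : ℝ) ^ n = 3 ^ n * 2 ^ n := by rw [← mul_pow]; norm_num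
  have hpow' : (3 / 2 : ℝ) ^ n = 6 ^ n / 4 ^ n := by rw [← div_pow]; norm_num
  simp only [hexpect]
  refine (three_mul_sum_norm_stabExpect_sq_le _).trans_eq ?_
  rw [hnorm, htrace, ← hpow, hpow']
  ring

theorem three_mul_integral_norm_outputExpect_sq_le {ν : Measure (QubitUnitary n)}
    [IsProbabilityMeasure ν]
    (hν : ∀ V : Fin n → unitaryGroup (Fin 2) ℂ, ν.map (fun U => U * tensorUnitary V) = ν)
    (X : QubitUnitary n) :
    3 * ∫ W, ‖outputExpect X.1 W‖ ^ 2 ∂ν ≤ 1 + 2 * (‖X.1.trace‖ ^ 2 / 4 ^ n) := by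
  have hpreserving (s : Fin n → Fin 6) :
      MeasurePreserving (fun W => W * tensorUnitary fun i => stabUnitary (s i)) ν ν :=
    ⟨(Continuous.subtype_mk (continuous_subtype_val.matrix_mul continuous_const) _).measurable,
      hν fun i => stabUnitary (s i)⟩
  have hint : Integrable (fun W => 3 * ‖outputExpect X.1 W‖ ^ 2) ν :=
    integrable_of_continuous (((continuous_outputExpect X.1).norm.pow 2).const_mul 3)
  have hmean := card_mul_integral_le_of_measurePreserving hpreserving hint fun W => by
    rw [← Finset.mul_sum]
    exact three_mul_sum_norm_outputExpect_sq_le X W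
  rw [Fintype.card_fun, Fintype.card_fin, Fintype.card_fin, Nat.cast_pow, Nat.cast_ofNat,
    integral_const_mul] at hmean
  exact le_of_mul_le_mul_left hmean (by positivity)

theorem norm_inner_column_mul_zero (U V W : QubitUnitary n) :
    ‖inner ℂ (column (U * W) 0) (column (V * W) 0)‖ = ‖outputExpect (U⁻¹ * V).1 W‖ := by
  rw [inner_column]
  simp [outputExpect, conjTranspose_mul, Matrix.mul_assoc, star_eq_conjTranspose]

theorem rmsDist_map_conjState_zeroState_sq (ν : Measure (QubitUnitary n)) [IsProbabilityMeasure ν]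
    (U V : QubitUnitary n) :
    rmsDist (ν.map fun W => conjState W (zeroState n)) (conjState U) (conjState V) ^ 2 =
      1 - ∫ W, ‖outputExpect (U⁻¹ * V).1 W‖ ^ 2 ∂ν := by
  have hint : Integrable (fun W => ‖outputExpect (U⁻¹ * V).1 W‖ ^ 2) ν :=
    integrable_of_continuous ((continuous_outputExpect _).norm.pow 2)
  have hmeas : Measurable fun ρ => traceDist (conjState U ρ) (conjState V ρ) ^ 2 :=
    ((continuous_traceDist.comp (f := fun ρ => (conjState U ρ, conjState V ρ))
      ((continuous_conjState U).prodMk (continuous_conjState V))).pow 2).measurable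
  rw [rmsDist, Real.sq_sqrt (integral_nonneg fun _ => sq_nonneg _),
    integral_map (continuous_conjState_left _).measurable.aemeasurable hmeas.aestronglyMeasurable]
  have hvalue (W : QubitUnitary n) :
      traceDist (conjState U (conjState W (zeroState n))) (conjState V (conjState W (zeroState n)))
        ^ 2 = 1 - ‖outputExpect (U⁻¹ * V).1 W‖ ^ 2 := by
    rw [conjState_conjState, conjState_conjState, conjState_zeroState, conjState_zeroState,
      traceDist_pureState_sq, norm_inner_column_mul_zero]
  simp only [hvalue]
  rw [integral_sub (integrable_const _) hint]
  simp

namespace IsLocallyScrambled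

variable {P : Measure (DensityMatrix (Qubits n))}

theorem isProbabilityMeasure (hP : IsLocallyScrambled P) : IsProbabilityMeasure P := by
  obtain ⟨ν, hν, -, rfl⟩ := hP
  exact Measure.isProbabilityMeasure_map (continuous_conjState_left _).measurable.aemeasurable

theorem support_subset_range (hP : IsLocallyScrambled P) :
    P.support ⊆ Set.range fun U : QubitUnitary n => conjState U (zeroState n) := by
  obtain ⟨ν, -, -, rfl⟩ := hP
  exact support_map_conjState_subset_range ν _

theorem two_thirds_mul_infidelity_le_rmsDist_sq (hP : IsLocallyScrambled P)
    (U V : QubitUnitary n) :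
    2 / 3 * infidelity U V ≤ rmsDist P (conjState U) (conjState V) ^ 2 := by
  obtain ⟨ν, hν, ⟨ν', hν', hinv, hmoment⟩, rfl⟩ := hP
  have hmean : ∫ W, ‖outputExpect (U⁻¹ * V).1 W‖ ^ 2 ∂ν =
      ∫ W, ‖outputExpect (U⁻¹ * V).1 W‖ ^ 2 ∂ν' := by
    apply Complex.ofReal_injective
    rw [integral_norm_outputExpect_sq, integral_norm_outputExpect_sq, hmoment]
  have hcard : (Fintype.card (Qubits n) : ℝ) ^ 2 = 4 ^ n := by
    rw [Fintype.card_fun, Fintype.card_fin, Fintype.card_fin, Nat.cast_pow, ← pow_mul, mul_comm,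
      pow_mul]
    norm_num
  have hbound := three_mul_integral_norm_outputExpect_sq_le hinv (U⁻¹ * V)
  rw [rmsDist_map_conjState_zeroState_sq, hmean, infidelity, hcard]
  change _ ≤ 1 + 2 * (‖(U.1ᴴ * V.1).trace‖ ^ 2 / 4 ^ n) at hbound
  linarith

end IsLocallyScrambled

end LocallyScrambled

/-! ### The sample complexity of learning an arbitrary unitary -/

section SampleComplexity

variable {n : ℕ} {a ε η : ℝ}

theorem four_pow_mul_log_le_log_packingNumber {P : Measure (DensityMatrix (Qubits n))} {x : ℝ}
    (hP : IsLocallyScrambled P) (hn : 1 ≤ n) (hx : 0 < x) (hx' : x ≤ 1 / 320)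
    (hM : packingNumber (conjState '' (Set.univ : Set (QubitUnitary n))) (rmsDist P) x ≠ ⊤) :
    4 ^ n * Real.log (1 / (20 * x)) ≤
      4 * Real.log (packingNumber (conjState '' (Set.univ : Set (QubitUnitary n)))
        (rmsDist P) x).toNat := by
  have hseparated (U V : QubitUnitary n) (hUV : (20 * x) ^ 2 / 256 < infidelity U V) :
      x < rmsDist P (conjState U) (conjState V) := by
    refine lt_of_pow_lt_pow_left₀ 2 (Real.sqrt_nonneg _) ?_
    linarith [hP.two_thirds_mul_infidelity_le_rmsDist_sq U V, sq_nonneg x]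
  have hpacking := packingNumber_le_of_mapsTo (Set.mapsTo_image conjState Set.univ)
    (fun g _ => rmsDist_self.trans_le hx.le) fun U _ V _ => hseparated U V
  rw [← ENat.natCast_toNat hM] at hpacking
  have hcard : Fintype.card (Qubits n) = 2 * 2 ^ (n - 1) := by
    rw [Fintype.card_fun, Fintype.card_fin, Fintype.card_fin, mul_pow_sub_one (by lia)]
  have hlog := sq_mul_log_le_log_of_packingNumber_infidelity_le hcard Nat.one_le_two_pow
    (by positivity) (by linarith) hpacking
  have hpow : (4 : ℝ) ^ n = 4 * (2 ^ (n - 1)) ^ 2 := by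
    rw [← pow_mul, mul_comm (n - 1), pow_mul, ← mul_pow_sub_one (by lia : n ≠ 0)]
    norm_num
  push_cast at hlog
  rw [hpow]
  linarith

theorem log_maxCoveringNumber_conjState_le {S : Set (DensityMatrix (Qubits n))}
    (hS : S ⊆ Set.range fun U : QubitUnitary n => conjState U (zeroState n)) (hη : 0 < η)
    (hη1 : η ≤ 1) (𝒰 : Set (QubitUnitary n)) :
    Real.log (maxCoveringNumber conjState 𝒰 S η).toNat ≤ 2 * 2 ^ n * Real.log (3 / η) := by
  have hcover : maxCoveringNumber conjState 𝒰 S η ≤ ⌊(1 + 2 / η) ^ (2 * 2 ^ n)⌋₊ := by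
    refine iSup₂_le fun ρ hρ => (coveringNumber_pureState_le hη ?_).trans_eq (by simp)
    obtain ⟨W, rfl⟩ := hS hρ
    rintro _ ⟨V, -, rfl⟩
    exact ⟨_, norm_column (V * W) 0,
      (conjState_zeroState _).symm.trans (conjState_conjState V W _).symm⟩
  have hbase : 1 + 2 / η ≤ 3 / η := by
    rw [le_div_iff₀ hη, add_mul, div_mul_cancel₀ _ hη.ne']
    linarith
  set q := (maxCoveringNumber conjState 𝒰 S η).toNat
  have hq : (q : ℝ) ≤ (3 / η) ^ (2 * 2 ^ n) :=
    calc (q : ℝ) ≤ ⌊(1 + 2 / η) ^ (2 * 2 ^ n)⌋₊ :=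
          Nat.cast_le.2 (ENat.toNat_le_of_le_natCast hcover)
      _ ≤ (1 + 2 / η) ^ (2 * 2 ^ n) := Nat.floor_le (by positivity)
      _ ≤ (3 / η) ^ (2 * 2 ^ n) := by gcongr
  rcases Nat.eq_zero_or_pos q with hq0 | hq0
  · rw [hq0, Nat.cast_zero, Real.log_zero]
    have hlog : 0 ≤ Real.log (3 / η) := Real.log_nonneg (by rw [le_div_iff₀ hη]; linarith)
    positivity
  · simpa only [Real.log_pow, Nat.cast_mul, Nat.cast_pow, Nat.cast_ofNat] using
      Real.log_le_log (Nat.cast_pos.2 hq0) hq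

/-- An upper bound on `log (3 / η) / log (1 / (20 (2 ε + 6 η)))` for `a ε ≤ η`. It arises from
`2 ε + 6 η ≤ (2 / a + 6) η`, and `log 16` is the least value of the denominator for
`2 ε + 6 η ≤ 1 / 320`. -/
def logScaleRatio (a : ℝ) : ℝ := 1 + Real.log (60 * (2 / a + 6)) / Real.log 16

theorem logScaleRatio_pos (ha : 0 < a) : 0 < logScaleRatio a := by
  have hratio : 0 < 2 / a := by positivity
  have hlog : 0 ≤ Real.log (60 * (2 / a + 6)) := Real.log_nonneg (by linarith)
  have hlog16 : 0 < Real.log 16 := Real.log_pos (by norm_num)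
  exact add_pos_of_pos_of_nonneg one_pos (div_nonneg hlog hlog16.le)

theorem log_three_div_le_mul_logScaleRatio (ha : 0 < a) (hε : 0 ≤ ε) (hη : 0 < η)
    (haη : a * ε ≤ η) (hδ : 2 * ε + 6 * η ≤ 1 / 320) :
    Real.log (3 / η) ≤ Real.log (1 / (20 * (2 * ε + 6 * η))) * logScaleRatio a := by
  have hratio : 0 < 2 / a := by positivity
  have hscale : 2 * ε + 6 * η ≤ (2 / a + 6) * η := by
    have hεη : ε ≤ η / a := by rw [le_div_iff₀ ha]; linarith
    calc 2 * ε + 6 * η ≤ 2 * (η / a) + 6 * η := by gcongr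
      _ = (2 / a + 6) * η := by ring
  have hlog16 : 0 < Real.log 16 := Real.log_pos (by norm_num)
  have hlog : Real.log 16 ≤ Real.log (1 / (20 * (2 * ε + 6 * η))) :=
    Real.log_le_log (by norm_num) (by rw [le_div_iff₀ (by positivity)]; linarith)
  have hlog' : 0 ≤ Real.log (60 * (2 / a + 6)) := Real.log_nonneg (by linarith)
  have hratio_le : 3 / η ≤ 1 / (20 * (2 * ε + 6 * η)) * (60 * (2 / a + 6)) := by
    rw [div_mul_eq_mul_div, div_le_div_iff₀ hη (by positivity)]
    linarith
  calc Real.log (3 / η)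
      ≤ Real.log (1 / (20 * (2 * ε + 6 * η)) * (60 * (2 / a + 6))) :=
        Real.log_le_log (by positivity) hratio_le
    _ = Real.log (1 / (20 * (2 * ε + 6 * η))) +
        Real.log 16 * (Real.log (60 * (2 / a + 6)) / Real.log 16) := by
        rw [Real.log_mul (by positivity) (by positivity), mul_div_cancel₀ _ hlog16.ne']
    _ ≤ Real.log (1 / (20 * (2 * ε + 6 * η))) + Real.log (1 / (20 * (2 * ε + 6 * η))) *
        (Real.log (60 * (2 / a + 6)) / Real.log 16) := by gcongr
    _ = _ := by rw [logScaleRatio]; ring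

theorem Learns.two_pow_le_mul {P : Measure (DensityMatrix (Qubits n))} {N : ℕ} {Ω : Type*}
    [MeasurableSpace Ω] {μ : Measure Ω} [IsProbabilityMeasure μ]
    {H : Learner Ω P.support (DensityMatrix (Qubits n)) (QubitUnitary n)}
    (hL : Learns μ conjState Set.univ P.support P ε η N H) (hP : IsLocallyScrambled P)
    (hn : 1 ≤ n) (ha : 0 < a) (hε : 0 ≤ ε) (hη : 0 < η) (haη : a * ε ≤ η)
    (hδ : 2 * ε + 6 * η ≤ 1 / 320) : 2 ^ n ≤ 16 * logScaleRatio a * N := by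
  have := hP.isProbabilityMeasure
  have hx : 0 < 2 * ε + 6 * η := by positivity
  obtain ⟨hM, hmain⟩ := hL.log_packingNumber_le (r := 2 * ε + 6 * η)
    (fun V => (continuous_conjState V).measurable) hη (by linarith)
  have hpacking := four_pow_mul_log_le_log_packingNumber hP hn hx hδ hM
  have hcovering :=
    log_maxCoveringNumber_conjState_le hP.support_subset_range hη (by linarith) Set.univ
  have hscale := log_three_div_le_mul_logScaleRatio ha hε hη haη hδ
  set ℓ := Real.log (1 / (20 * (2 * ε + 6 * η)))
  have hℓ : 0 < ℓ := Real.log_pos (by rw [lt_div_iff₀ (by positivity)]; linarith)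
  have hpow : (4 : ℝ) ^ n = 2 ^ n * 2 ^ n := by rw [← mul_pow]; norm_num
  have hchain : 1 / 8 * (4 ^ n * ℓ) ≤ N * (2 * 2 ^ n * (ℓ * logScaleRatio a)) :=
    calc 1 / 8 * (4 ^ n * ℓ)
        ≤ N * Real.log (maxCoveringNumber conjState Set.univ P.support η).toNat := by linarith
      _ ≤ N * (2 * 2 ^ n * (ℓ * logScaleRatio a)) := by gcongr; exact hcovering.trans (by gcongr)
  refine le_of_mul_le_mul_left (?_ : 2 ^ n * ℓ / 8 * 2 ^ n ≤ _) (by positivity)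
  rw [hpow] at hchain
  linarith

end SampleComplexity

end QNFL

end

open MeasureTheory QNFL in
theorem mainTheorem8_general :
    (∃ c : ℝ, 0 < c ∧
      ∀ (G : Type*) (ι : Type*) [Fintype ι] (κ : Type*) [Fintype κ] [DecidableEq κ]
        (f : G → DensityMatrix ι → DensityMatrix κ) (_ : ∀ V, Measurable (f V))
        (𝒰 : Set G) (S : Set (DensityMatrix ι)) (P : Measure (DensityMatrix ι)) [IsFiniteMeasure P]
        (ε η r : ℝ) (_ : 0 < η) (_ : 2 * ε ≤ r) (N : ℕ)
        (Ω : Type*) [MeasurableSpace Ω] (μ : Measure Ω) [IsProbabilityMeasure μ]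
        (H : Learner Ω S (DensityMatrix κ) G),
        Learns μ f 𝒰 S P ε η N H →
          packingNumber (f '' 𝒰) (rmsDist P) r ≠ ⊤ ∧
          maxCoveringNumber f 𝒰 S η ≠ ⊤ ∧
          c * Real.log (packingNumber (f '' 𝒰) (rmsDist P) r).toNat ≤
            N * Real.log (maxCoveringNumber f 𝒰 S η).toNat) ∧
    (∃ δ : ℝ, 0 < δ ∧ ∀ a : ℝ, 0 < a → ∃ c : ℝ, 0 < c ∧
      ∀ (n : ℕ) (_ : 1 ≤ n) (P : Measure (DensityMatrix (Qubits n))) (_ : IsLocallyScrambled P)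
        (ε η : ℝ) (_ : 0 ≤ ε) (_ : 0 < η) (_ : a * ε ≤ η) (_ : 2 * ε + 6 * η ≤ δ) (N : ℕ)
        (Ω : Type*) [MeasurableSpace Ω] (μ : Measure Ω) [IsProbabilityMeasure μ]
        (H : Learner Ω P.support (DensityMatrix (Qubits n)) (QubitUnitary n)),
        Learns μ conjState Set.univ P.support P ε η N H → c * 2 ^ n ≤ (N : ℝ)) := by
  refine ⟨⟨1 / 2, by norm_num, ?_⟩, 1 / 320, by norm_num, fun a ha => ?_⟩
  · intro G ι _ κ _ _ f hf 𝒰 S P _ ε η r hη hr N Ω _ μ _ H hL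
    obtain ⟨hfinite, hlog⟩ := hL.log_packingNumber_le hf hη hr
    exact ⟨hfinite, maxCoveringNumber_ne_top hη, hlog⟩
  · have hratio : 0 < 16 * logScaleRatio a := mul_pos (by norm_num) (logScaleRatio_pos ha)
    refine ⟨(16 * logScaleRatio a)⁻¹, inv_pos.2 hratio, ?_⟩
    intro n hn P hP ε η hε hη haη hδ N Ω _ μ _ H hL
    rw [inv_mul_le_iff₀ hratio]
    exact hL.two_pow_le_mul hP hn ha hε hη haη hδ

open MeasureTheory QNFL in
theorem mainTheorem8 :
    (∃ c : ℝ, 0 < c ∧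
      ∀ (n : ℕ) (ι : Type*) [Fintype ι] (κ : Type*) [Fintype κ] [DecidableEq κ]
        (f : QubitUnitary n → DensityMatrix ι → DensityMatrix κ) (_ : ∀ V, Measurable (f V))
        (𝒰 : Set (QubitUnitary n)) (S : Set (DensityMatrix ι))
        (P : Measure (DensityMatrix ι)) [IsProbabilityMeasure P] (_ : ∀ᵐ ρ ∂P, ρ ∈ S)
        (ε η : ℝ) (_ : ε ∈ Set.Ioo (0 : ℝ) 1) (_ : η ∈ Set.Ioo (0 : ℝ) 1) (N : ℕ)
        (Ω : Type*) [MeasurableSpace Ω] (μ : Measure Ω) [IsProbabilityMeasure μ]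
        (H : Learner Ω S (DensityMatrix κ) (QubitUnitary n)),
        Learns μ f 𝒰 S P ε η N H →
          packingNumber (f '' 𝒰) (rmsDist P) (2 * ε + 6 * η) ≠ ⊤ ∧
          maxCoveringNumber f 𝒰 S η ≠ ⊤ ∧
          c * Real.log (packingNumber (f '' 𝒰) (rmsDist P) (2 * ε + 6 * η)).toNat ≤
            N * Real.log (maxCoveringNumber f 𝒰 S η).toNat) ∧
    (∃ δ : ℝ, 0 < δ ∧ ∀ a b : ℝ, 0 < a → a ≤ b → ∃ c : ℝ, 0 < c ∧
      ∀ (n : ℕ) (_ : 1 ≤ n) (P : Measure (DensityMatrix (Qubits n))) (_ : IsLocallyScrambled P)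
        (ε η : ℝ) (_ : ε ∈ Set.Ioo (0 : ℝ) 1) (_ : η ∈ Set.Ioo (0 : ℝ) 1)
        (_ : a * ε ≤ η) (_ : η ≤ b * ε) (_ : 2 * ε + 6 * η ≤ δ) (N : ℕ)
        (Ω : Type*) [MeasurableSpace Ω] (μ : Measure Ω) [IsProbabilityMeasure μ]
        (H : Learner Ω P.support (DensityMatrix (Qubits n)) (QubitUnitary n)),
        Learns μ conjState Set.univ P.support P ε η N H → c * 2 ^ n ≤ (N : ℝ)) := by
  obtain ⟨⟨c, hc, hpacking⟩, δ, hδ, hscrambled⟩ := mainTheorem8_general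
  refine ⟨⟨c, hc, fun n ι _ κ _ _ f hf 𝒰 S P _ _ ε η _ hη N Ω _ μ _ H =>
    hpacking _ ι κ f hf 𝒰 S P ε η _ hη.1 (by linarith [hη.1]) N Ω μ H⟩,
    δ, hδ, fun a b ha _ => (hscrambled a ha).imp fun c hc => ⟨hc.1, ?_⟩⟩
  exact fun n hn P hP ε η hε hη haη _ => hc.2 n hn P hP ε η hε.1.le hη.1 haη
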